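/- Let $1 \le \ell \le d$ be integers and let $U : \mathbb{R}^d \to \mathbb{R}$ be a convex, differentiable function such that $\nabla U$ is $L$-Lipschitz and $x \mapsto U(x) - \frac{\lambda}{2}\|x\|^2$ is convex for some $\lambda > 0$. Assume that $\pi(dx) = e^{-U(x)}\,dx$ is a probability measure on $\mathbb{R}^d$, and put $\kappa = L/\lambda$. Let $V_\ell(\mathbb{R}^d)$ be the set of orthonormal $\ell$-frames $\mathbf{v} = (v_1,\dots,v_\ell)$ in $\mathbb{R}^d$, let $\sigma^{(\ell)}$ be the uniform (rotation invariant, Haar) probability measure on it, and for $\mathbf{v} \in V_\ell(\mathbb{R}^d)$ let $p_{\mathbf{v}} : \mathbb{R}^d \to \mathbb{R}^d$ be the orthogonal projection onto $\mathrm{span}(v_1,\dots,v_\ell)$. Write $\mathrm{KL}(\cdot\,|\,\cdot) \in [0,+\infty]$ for the Kullback-Leibler divergence and $(p_{\mathbf{v}})_\#$ for the push-forward of measures. Then: 1. For every Borel probability measure $\mu$ on $\mathbb{R}^d$, the function $\mathbf{v} \mapsto \mathrm{KL}\big((p_{\mathbf{v}})_\#\mu \,|\, (p_{\mathbf{v}})_\#\pi\big)$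 is $\sigma^{(\ell)}$-measurable and $$\int_{V_\ell(\mathbb{R}^d)} \mathrm{KL}\big((p_{\mathbf{v}})_\#\mu \,|\, (p_{\mathbf{v}})_\#\pi\big)\,\sigma^{(\ell)}(d\mathbf{v}) \le \Big(1 - \frac{d-\ell}{\kappa d}\Big)\,\mathrm{KL}(\mu|\pi).$$ 2. If $X$ is a random vector with law $\pi$, then for every real-valued $f \in L^2(\pi)$ the function $\mathbf{v} \mapsto \mathbb{E}\big[\mathrm{Var}(f(X)\,|\,p_{\mathbf{v}}(X))\big]$ is $\sigma^{(\ell)}$-integrable and $$\int_{V_\ell(\mathbb{R}^d)} \mathbb{E}\big[\mathrm{Var}(f(X)\,|\,p_{\mathbf{v}}(X))\big]\,\sigma^{(\ell)}(d\mathbf{v}) \ge \frac{d-\ell}{2\kappa d}\,\mathrm{Var}(f(X)).$$ -/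

import Mathlib

open MeasureTheory ProbabilityTheory InformationTheory

open scoped ENNReal

noncomputable section

/-- The measure `exp (-U(x)) dx` on `ℝ^d`. -/
def gibbsMeasure {d : ℕ} (U : EuclideanSpace ℝ (Fin d) → ℝ) :
    Measure (EuclideanSpace ℝ (Fin d)) :=
  volume.withDensity fun x => ENNReal.ofReal (Real.exp (-U x))

/-- `U` is convex, `L`-smooth (differentiable with `L`-Lipschitz gradient) and `lam`-convex
(`U - (lam / 2) ‖·‖²` is convex) with `lam > 0`. -/
structure IsConvexSmooth {d : ℕ} (U : EuclideanSpace ℝ (Fin d) → ℝ) (lam L : ℝ) : Prop where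
  convex : ConvexOn ℝ Set.univ U
  differentiable : Differentiable ℝ U
  lipschitz_gradient : ∀ x y, ‖gradient U x - gradient U y‖ ≤ L * ‖x - y‖
  lam_pos : 0 < lam
  lam_convex : ConvexOn ℝ Set.univ fun x => U x - lam / 2 * ‖x‖ ^ 2

/-- The Stiefel manifold of orthonormal `l`-frames in `ℝ^d`. -/
abbrev Stiefel (l d : ℕ) : Type :=
  {v : Fin l → EuclideanSpace ℝ (Fin d) // Orthonormal ℝ v}

/-- The orthogonal group of `ℝ^d`. -/
abbrev OrthGroup (d : ℕ) : Type := Matrix.orthogonalGroup (Fin d) ℝ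

instance OrthGroup.instMeasurableSpace (d : ℕ) : MeasurableSpace (OrthGroup d) := borel _

instance OrthGroup.instBorelSpace (d : ℕ) : BorelSpace (OrthGroup d) := ⟨rfl⟩

theorem isCompact_orthogonalGroup (d : ℕ) :
    IsCompact (Matrix.orthogonalGroup (Fin d) ℝ : Set (Matrix (Fin d) (Fin d) ℝ)) := by
  have hK : IsCompact {A : Matrix (Fin d) (Fin d) ℝ |
      ∀ i, A i ∈ {r : Fin d → ℝ | ∀ j, r j ∈ Set.Icc (-1 : ℝ) 1}} :=
    isCompact_pi_infinite fun _ => isCompact_pi_infinite fun _ => isCompact_Icc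
  refine hK.of_isClosed_subset ?_ ?_
  · have : (Matrix.orthogonalGroup (Fin d) ℝ : Set (Matrix (Fin d) (Fin d) ℝ)) =
        {A | A * star A = 1} := by
      ext A
      exact Matrix.mem_orthogonalGroup_iff (Fin d) ℝ
    rw [this]
    exact isClosed_eq (by fun_prop) continuous_const
  · intro A hA i j
    have := entry_norm_bound_of_unitary (𝕜 := ℝ) hA i j
    rw [Real.norm_eq_abs] at this
    exact abs_le.mp this

instance OrthGroup.instCompactSpace (d : ℕ) : CompactSpace (OrthGroup d) :=
  isCompact_iff_compactSpace.mp (isCompact_orthogonalGroup d)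

/-- The Haar probability measure on the orthogonal group. -/
def haarOrth (d : ℕ) : Measure (OrthGroup d) :=
  Measure.haarMeasure ⊤

instance haarOrth.instIsProbabilityMeasure (d : ℕ) : IsProbabilityMeasure (haarOrth d) :=
  ⟨by
    have h := Measure.haarMeasure_self
      (K₀ := (⊤ : TopologicalSpace.PositiveCompacts (OrthGroup d)))
    simpa [haarOrth] using h⟩

/-- The frame `(R e_1, …, R e_l)` made of the first `l` columns of an orthogonal matrix `R`. -/
def frameOf {l d : ℕ} (h : l ≤ d) (R : OrthGroup d) : Stiefel l d :=
  ⟨fun i => WithLp.toLp 2 fun k => (R : Matrix (Fin d) (Fin d) ℝ) k (Fin.castLE h i), by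
    rw [orthonormal_iff_ite]
    intro i j
    have hR := (Matrix.mem_orthogonalGroup_iff' (Fin d) ℝ).mp R.2
    have := congrFun (congrFun hR (Fin.castLE h i)) (Fin.castLE h j)
    simp only [Matrix.mul_apply, Matrix.one_apply,
      (Fin.castLE_injective h).eq_iff] at this
    rw [← this, PiLp.inner_apply]
    simp [mul_comm]⟩

theorem continuous_frameOf {l d : ℕ} (h : l ≤ d) : Continuous (frameOf h) := by
  refine Continuous.subtype_mk (continuous_pi fun i => ?_) _
  refine (PiLp.continuous_toLp 2 _).comp (continuous_pi fun k => ?_)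
  exact (continuous_apply (Fin.castLE h i)).comp
    ((continuous_apply k).comp continuous_subtype_val)

/-- The uniform probability measure on orthonormal `l`-frames: the law of `(R e_1, …, R e_l)`
for a Haar-distributed orthogonal matrix `R`. -/
def stiefelUniform {l d : ℕ} (h : l ≤ d) : Measure (Stiefel l d) :=
  (haarOrth d).map (frameOf h)

instance stiefelUniform.instIsProbabilityMeasure {l d : ℕ} (h : l ≤ d) :
    IsProbabilityMeasure (stiefelUniform h) :=
  Measure.isProbabilityMeasure_map (continuous_frameOf h).measurable.aemeasurable

/-- The action of an orthogonal matrix on frames, vector by vector. -/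
def rotateFrame {l d : ℕ} (Q : OrthGroup d) (v : Stiefel l d) : Stiefel l d :=
  ⟨fun i => WithLp.toLp 2 ((Q : Matrix (Fin d) (Fin d) ℝ).mulVec (v.1 i).ofLp), by
    have hv := orthonormal_iff_ite.mp v.2
    have hQ := (Matrix.mem_orthogonalGroup_iff' (Fin d) ℝ).mp Q.2
    rw [orthonormal_iff_ite]
    intro i j
    rw [← hv i j, EuclideanSpace.inner_eq_star_dotProduct,
      EuclideanSpace.inner_eq_star_dotProduct]
    simp only [star_trivial]
    rw [Matrix.dotProduct_mulVec, Matrix.vecMul_mulVec]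
    have hQ' : (Q : Matrix (Fin d) (Fin d) ℝ).transpose * (Q : Matrix (Fin d) (Fin d) ℝ) = 1 := hQ
    rw [hQ']
    simp⟩

/-- The measure `stiefelUniform` is invariant under rotations. -/
theorem map_rotateFrame_stiefelUniform {l d : ℕ} (h : l ≤ d) (Q : OrthGroup d) :
    (stiefelUniform h).map (rotateFrame Q) = stiefelUniform h := by
  have hcont : Continuous (rotateFrame Q : Stiefel l d → Stiefel l d) := by
    refine Continuous.subtype_mk (continuous_pi fun i => ?_) _
    refine (PiLp.continuous_toLp 2 _).comp ?_
    refine Continuous.matrix_mulVec continuous_const ?_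
    exact (PiLp.continuous_ofLp 2 _).comp ((continuous_apply i).comp continuous_subtype_val)
  have hcomp : rotateFrame Q ∘ frameOf h = frameOf h ∘ fun R => Q * R := by
    funext R
    apply Subtype.ext
    funext i
    ext k
    simp [rotateFrame, frameOf, Matrix.mulVec, dotProduct, Matrix.mul_apply]
  have : (haarOrth d).IsMulLeftInvariant := by unfold haarOrth; infer_instance
  unfold stiefelUniform
  rw [Measure.map_map hcont.measurable (continuous_frameOf h).measurable, hcomp,
    ← Measure.map_map (continuous_frameOf h).measurable (continuous_const_mul Q).measurable,
    map_mul_left_eq_self]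

/-- The orthogonal projection of `ℝ^d` onto the span of the frame `v`, as a map `ℝ^d → ℝ^d`. -/
def frameProj {l d : ℕ} (v : Stiefel l d) :
    EuclideanSpace ℝ (Fin d) → EuclideanSpace ℝ (Fin d) :=
  (Submodule.span ℝ (Set.range v.1)).starProjection

end

/-! Fix an orthonormal basis and average over the `d` cyclic windows of `l` basis vectors, with
weights `w j = 1 / d`. Let `P_j` project onto the span of the vectors outside window `j`. Each basis
vector is outside with total weight `W = (d - l) / d`, so `∑ w_j P_j = W • id` and `∑ w_j ‖P_j z‖² =
W ‖z‖²`. Using the quadratic upper bound on `U` (constant `L`) at the points `x + t P_j (y - x)` and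
the quadratic lower bound (constant `lam`) at `y`, one gets, for `t ≤ lam / L`, `∑ w_j U(x + t P_j
(y - x)) ≤ (1 - t W) U(x) + t W U(y)`.

This is the pointwise hypothesis of a Prékopa-Leindler inequality in which the `j`-th function sees
only the coordinates in `P_j` interpolated (`prekopaLeindler_family_basis`). Applied to `exp (h -
U)`, `exp (-U)` and `exp (g_j - U)`, where `g_j` is invariant along the range of `P_j` and `h = (1 -
t W)⁻¹ ∑ w_j g_j`, it yields `(∫ exp h dπ)^(1 - t W) ≤ ∏ (∫ exp g_j dπ)^(w_j)`. By the variational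
formula for relative entropy, this gives `∑ w_j KL(p_j μ | p_j π) ≤ (1 - t W) KL(μ | π)`, and `t`
tends to `lam / L`. Haar measure is invariant under permutations of the columns, so the average over
windows integrates to the average over all frames.

The variance statement is the linearisation at `π`: for the density `1 + ε Y` with `Y` bounded and
centred, the entropy of an image is `ε² / 2` times the variance of the conditional expectation of
`Y`, up to `O(ε³)` uniformly in the frame. Density of simple functions in L² and the law of total
variance conclude, with a constant twice as good as the one required. -/

/-! ### Brunn-Minkowski and Prékopa-Leindler on the line. -/

/-- One-dimensional Brunn-Minkowski inequality for compact sets. -/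
theorem volume_add_volume_le_of_isCompact {X Y Z : Set ℝ} (hX : IsCompact X) (hY : IsCompact Y)
    (hX0 : X.Nonempty) (hY0 : Y.Nonempty) (hZ : ∀ x ∈ X, ∀ y ∈ Y, x + y ∈ Z) :
    volume X + volume Y ≤ volume Z := by
  -- The translates `X + min Y` and `max X + Y` both lie in `Z` and meet only at `max X + min Y`.
  obtain ⟨a, haX, ha⟩ := hX.exists_isGreatest hX0
  obtain ⟨b, hbY, hb⟩ := hY.exists_isLeast hY0
  have hX' : volume ((fun x => x + b) '' X) = volume X := by
    rw [Set.image_add_right]; exact measure_preimage_add_right _ _ _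
  have hY' : volume ((fun y => a + y) '' Y) = volume Y := by
    rw [Set.image_add_left]; exact measure_preimage_add _ _ _
  rw [← hX', ← hY', ← measure_union₀]
  · refine measure_mono ?_
    rintro _ (⟨x, hx, rfl⟩ | ⟨y, hy, rfl⟩)
    · exact hZ _ hx _ hbY
    · exact hZ _ haX _ hy
  · exact (hY.image (by fun_prop)).measurableSet.nullMeasurableSet
  · refine measure_mono_null (t := {a + b}) ?_ (by simp)
    rintro _ ⟨⟨x, hx, rfl⟩, ⟨y, hy, h⟩⟩
    have h1 := ha hx
    have h2 := hb hy
    simp only [Set.mem_singleton_iff] at *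
    linarith

/-- One-dimensional Brunn-Minkowski inequality. -/
theorem volume_add_volume_le {X Y Z : Set ℝ} (hX : MeasurableSet X) (hY : MeasurableSet Y)
    (hX0 : X.Nonempty) (hY0 : Y.Nonempty) (hZ : ∀ x ∈ X, ∀ y ∈ Y, x + y ∈ Z) :
    volume X + volume Y ≤ volume Z := by
  rw [hX.measure_eq_iSup_isCompact, hY.measure_eq_iSup_isCompact]
  obtain ⟨x₀, hx₀⟩ := hX0
  obtain ⟨y₀, hy₀⟩ := hY0
  have key : ∀ K₁ ⊆ X, IsCompact K₁ → ∀ K₂ ⊆ Y, IsCompact K₂ →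
      volume K₁ + volume K₂ ≤ volume Z := by
    intro K₁ h₁ hK₁ K₂ h₂ hK₂
    -- Adding `x₀` and `y₀` keeps the compact sets nonempty.
    refine le_trans (add_le_add (measure_mono (Set.subset_insert x₀ K₁))
      (measure_mono (Set.subset_insert y₀ K₂))) ?_
    exact volume_add_volume_le_of_isCompact (hK₁.insert x₀) (hK₂.insert y₀) ⟨x₀, by simp⟩
      ⟨y₀, by simp⟩ fun x hx y hy =>
        hZ x (Set.insert_subset hx₀ h₁ hx) y (Set.insert_subset hy₀ h₂ hy)
  simp only [iSup_and']
  refine ENNReal.biSup_add_biSup_le' ⟨∅, Set.empty_subset _, isCompact_empty⟩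
    ⟨∅, Set.empty_subset _, isCompact_empty⟩ ?_
  intro K₁ h₁ K₂ h₂
  exact key K₁ h₁.1 h₁.2 K₂ h₂.1 h₂.2

theorem lintegral_eq_lintegral_volume_lt {f : ℝ → ℝ≥0∞} (hf : Measurable f) (h1 : ∀ x, f x ≤ 1) :
    ∫⁻ x, f x = ∫⁻ s in Set.Ioo (0 : ℝ) 1, volume {x | ENNReal.ofReal s < f x} := by
  have hfin : ∀ x, f x ≠ ∞ := fun x => ne_top_of_le_ne_top ENNReal.one_ne_top (h1 x)
  have h := lintegral_eq_lintegral_meas_lt volume (f := fun x => (f x).toReal)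
    (Filter.Eventually.of_forall fun x => ENNReal.toReal_nonneg) hf.ennreal_toReal.aemeasurable
  simp only [ENNReal.ofReal_toReal (hfin _)] at h
  rw [h, ← lintegral_indicator measurableSet_Ioi, ← lintegral_indicator measurableSet_Ioo]
  refine lintegral_congr_ae (Filter.Eventually.of_forall fun s => ?_)
  simp only [Set.indicator, Set.mem_Ioi, Set.mem_Ioo]
  by_cases hs : 0 < s
  · by_cases hs1 : s < 1
    · simp only [hs, hs1, and_self, if_true]
      congr 1
      ext x
      exact (ENNReal.ofReal_lt_iff_lt_toReal hs.le (hfin x)).symm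
    · simp only [hs, hs1, and_false, if_true, if_false]
      convert measure_empty (μ := (volume : Measure ℝ))
      ext x
      have : (f x).toReal ≤ 1 := ENNReal.toReal_mono ENNReal.one_ne_top (h1 x)
      simp only [Set.mem_ofPred_eq, Set.mem_empty_iff_false, iff_false, not_lt]
      linarith
  · simp [hs]

theorem rpow_mul_rpow_le_add {t : ℝ} (ht0 : 0 < t) (ht1 : t < 1) (a b : ℝ≥0∞) :
    a ^ (1 - t) * b ^ t ≤ ENNReal.ofReal (1 - t) * a + ENNReal.ofReal t * b := by
  have ht1' : 0 < 1 - t := by linarith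
  have hpq : (1 - t)⁻¹.HolderConjugate t⁻¹ := by
    rw [Real.holderConjugate_iff]
    exact ⟨(one_lt_inv₀ ht1').mpr (by linarith), by simp⟩
  have := ENNReal.young_inequality (a ^ (1 - t)) (b ^ t) hpq
  rw [← ENNReal.rpow_mul, ← ENNReal.rpow_mul, mul_inv_cancel₀ ht1'.ne', mul_inv_cancel₀ ht0.ne',
    ENNReal.ofReal_inv_of_pos ht1', ENNReal.ofReal_inv_of_pos ht0, div_eq_mul_inv, div_eq_mul_inv,
    inv_inv, inv_inv, ENNReal.rpow_one, ENNReal.rpow_one] at this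
  rwa [mul_comm _ a, mul_comm _ b]

/-- When both suprema are `1`, the superlevel sets of `A` and `B` are nonempty at every level in
`(0, 1)`, so Brunn-Minkowski applies level by level. The layer-cake formula then gives the
arithmetic-mean bound, which is stronger than the geometric one. -/
theorem prekopaLeindler_real_of_iSup_eq_one {t : ℝ} (ht0 : 0 < t) (ht1 : t < 1)
    {A B K : ℝ → ℝ≥0∞} (hA : Measurable A) (hB : Measurable B) (hK : Measurable K)
    (hA1 : ⨆ x, A x = 1) (hB1 : ⨆ x, B x = 1)
    (h : ∀ x y, A x ^ (1 - t) * B y ^ t ≤ K ((1 - t) * x + t * y)) :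
    (∫⁻ x, A x) ^ (1 - t) * (∫⁻ x, B x) ^ t ≤ ∫⁻ x, K x := by
  have hA1' : ∀ x, A x ≤ 1 := fun x => hA1 ▸ le_iSup A x
  have hB1' : ∀ x, B x ≤ 1 := fun x => hB1 ▸ le_iSup B x
  have ht1' : 0 < 1 - t := by linarith
  refine (rpow_mul_rpow_le_add ht0 ht1 _ _).trans ?_
  -- Only levels below `1` are controlled, so `K` is cut at `1`.
  have hK' : ∫⁻ x, min (K x) 1 ≤ ∫⁻ x, K x := lintegral_mono fun x => min_le_left _ _
  refine le_trans ?_ hK'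
  rw [lintegral_eq_lintegral_volume_lt hA hA1', lintegral_eq_lintegral_volume_lt hB hB1',
    lintegral_eq_lintegral_volume_lt (hK.min measurable_const) fun x => min_le_right _ _,
    ← lintegral_const_mul' _ _ ENNReal.ofReal_ne_top,
    ← lintegral_const_mul' _ _ ENNReal.ofReal_ne_top, ← lintegral_add_left']
  · refine setLIntegral_mono' measurableSet_Ioo fun s hs => ?_
    have hs1 : ENNReal.ofReal s < 1 := by simpa using hs.2
    have hvol : ∀ (r : ℝ), 0 < r → ∀ S : Set ℝ, volume ((fun x => r * x) '' S)
        = ENNReal.ofReal r * volume S := by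
      intro r hr S
      have := Measure.addHaar_smul (volume : Measure ℝ) r S
      simpa [abs_of_pos hr, ← Set.image_smul] using this
    have hmeas : ∀ (r : ℝ), 0 < r → ∀ S : Set ℝ, MeasurableSet S →
        MeasurableSet ((fun x => r * x) '' S) := fun r hr S hS =>
      (MeasurableEquiv.mulLeft₀ r hr.ne').measurableSet_image.mpr hS
    rw [← hvol _ ht1', ← hvol _ ht0]
    refine volume_add_volume_le (hmeas _ ht1' _ (measurableSet_lt measurable_const hA))
      (hmeas _ ht0 _ (measurableSet_lt measurable_const hB)) ?_ ?_ ?_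
    · obtain ⟨x, hx⟩ := lt_iSup_iff.mp (hA1 ▸ hs1)
      exact ⟨_, x, hx, rfl⟩
    · obtain ⟨x, hx⟩ := lt_iSup_iff.mp (hB1 ▸ hs1)
      exact ⟨_, x, hx, rfl⟩
    · rintro _ ⟨x, hx, rfl⟩ _ ⟨y, hy, rfl⟩
      simp only [Set.mem_ofPred_eq, lt_min_iff] at hx hy ⊢
      refine ⟨lt_of_lt_of_le ?_ (h x y), hs1⟩
      have hs0 : ENNReal.ofReal s ≠ 0 := by simpa using hs.1
      calc ENNReal.ofReal s = ENNReal.ofReal s ^ (1 - t) * ENNReal.ofReal s ^ t := by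
            rw [← ENNReal.rpow_add _ _ hs0 ENNReal.ofReal_ne_top]; simp
        _ < A x ^ (1 - t) * B y ^ t :=
            ENNReal.mul_lt_mul (ENNReal.rpow_lt_rpow hx ht1') (ENNReal.rpow_lt_rpow hy ht0)
  · refine AEMeasurable.const_mul ?_ _
    refine (Antitone.measurable ?_).aemeasurable
    intro s s' hss
    exact measure_mono fun x hx => lt_of_le_of_lt (ENNReal.ofReal_le_ofReal hss) hx

theorem prekopaLeindler_real_of_iSup_ne_top {t : ℝ} (ht0 : 0 < t) (ht1 : t < 1)
    {A B K : ℝ → ℝ≥0∞} (hA : Measurable A) (hB : Measurable B) (hK : Measurable K)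
    (hAt : ⨆ x, A x ≠ ∞) (hBt : ⨆ x, B x ≠ ∞)
    (h : ∀ x y, A x ^ (1 - t) * B y ^ t ≤ K ((1 - t) * x + t * y)) :
    (∫⁻ x, A x) ^ (1 - t) * (∫⁻ x, B x) ^ t ≤ ∫⁻ x, K x := by
  have ht1' : 0 < 1 - t := by linarith
  set a := ⨆ x, A x with ha
  set b := ⨆ x, B x with hb
  by_cases ha0 : a = 0
  · have : ∀ x, A x = 0 := fun x => le_antisymm (ha0 ▸ le_iSup A x) zero_le
    simp [this, ht1']
  by_cases hb0 : b = 0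
  · have : ∀ x, B x = 0 := fun x => le_antisymm (hb0 ▸ le_iSup B x) zero_le
    simp [this, ht0]
  set q := (a⁻¹) ^ (1 - t) * (b⁻¹) ^ t with hq
  have hai0 : a⁻¹ ≠ 0 := ENNReal.inv_ne_zero.mpr hAt
  have hbi0 : b⁻¹ ≠ 0 := ENNReal.inv_ne_zero.mpr hBt
  have hait : a⁻¹ ≠ ∞ := ENNReal.inv_ne_top.mpr ha0
  have hbit : b⁻¹ ≠ ∞ := ENNReal.inv_ne_top.mpr hb0
  have hq0 : q ≠ 0 := mul_ne_zero (by simp [hait, hAt]) (by simp [hbit, hBt])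
  have hqt : q ≠ ∞ := ENNReal.mul_ne_top (ENNReal.rpow_ne_top_of_nonneg ht1'.le hait)
    (ENNReal.rpow_ne_top_of_nonneg ht0.le hbit)
  have hsplit : ∀ u v : ℝ≥0∞, (a⁻¹ * u) ^ (1 - t) * (b⁻¹ * v) ^ t
      = q * (u ^ (1 - t) * v ^ t) := by
    intro u v
    rw [ENNReal.mul_rpow_of_nonneg _ _ ht1'.le, ENNReal.mul_rpow_of_nonneg _ _ ht0.le, hq]
    ring
  have := prekopaLeindler_real_of_iSup_eq_one ht0 ht1 (A := fun x => a⁻¹ * A x)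
    (B := fun x => b⁻¹ * B x) (K := fun x => q * K x) (hA.const_mul _) (hB.const_mul _)
    (hK.const_mul _) (by rw [← ENNReal.mul_iSup, ← ha, ENNReal.inv_mul_cancel ha0 hAt])
    (by rw [← ENNReal.mul_iSup, ← hb, ENNReal.inv_mul_cancel hb0 hBt])
    (fun x y => by rw [hsplit]; gcongr; exact h x y)
  rw [lintegral_const_mul _ hA, lintegral_const_mul _ hB, lintegral_const_mul _ hK, hsplit] at this
  exact (ENNReal.mul_le_mul_iff_right hq0 hqt).mp this

theorem tendsto_lintegral_min_natCast {f : ℝ → ℝ≥0∞} (hf : Measurable f) :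
    Filter.Tendsto (fun n : ℕ => ∫⁻ x, min (f x) n) Filter.atTop (nhds (∫⁻ x, f x)) := by
  refine lintegral_tendsto_of_tendsto_of_monotone
    (fun n => (hf.min measurable_const).aemeasurable) ?_ ?_
  · exact Filter.Eventually.of_forall fun x n m hnm => by
      dsimp only
      gcongr
  · refine Filter.Eventually.of_forall fun x => ?_
    have := (tendsto_const_nhds (x := f x)).min ENNReal.tendsto_nat_nhds_top
    simpa using this

/-- One-dimensional Prékopa-Leindler inequality. -/
theorem prekopaLeindler_real {t : ℝ} (ht0 : 0 < t) (ht1 : t < 1)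
    {A B K : ℝ → ℝ≥0∞} (hA : Measurable A) (hB : Measurable B) (hK : Measurable K)
    (h : ∀ x y, A x ^ (1 - t) * B y ^ t ≤ K ((1 - t) * x + t * y)) :
    (∫⁻ x, A x) ^ (1 - t) * (∫⁻ x, B x) ^ t ≤ ∫⁻ x, K x := by
  have ht1' : 0 < 1 - t := by linarith
  by_cases hA0 : ∫⁻ x, A x = 0
  · simp [hA0, ht1']
  by_cases hB0 : ∫⁻ x, B x = 0
  · simp [hB0, ht0]
  -- Truncating `A` and `B` at height `n` preserves the hypothesis with the same `K` and makes the
  -- suprema finite.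
  have hlim := ENNReal.Tendsto.mul
    ((tendsto_lintegral_min_natCast hA).ennrpow_const (1 - t)) (Or.inl (by simp [hA0, ht1'.not_gt]))
    ((tendsto_lintegral_min_natCast hB).ennrpow_const t) (Or.inl (by simp [hB0, ht0.not_gt]))
  refine le_of_tendsto' hlim fun n => ?_
  have hb : ∀ f : ℝ → ℝ≥0∞, ⨆ x, min (f x) n ≠ ∞ := fun f =>
    ne_top_of_le_ne_top (ENNReal.natCast_ne_top n) (iSup_le fun x => min_le_right _ _)
  refine prekopaLeindler_real_of_iSup_ne_top ht0 ht1 (hA.min measurable_const)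
    (hB.min measurable_const) hK (hb A) (hb B) fun x y => le_trans ?_ (h x y)
  gcongr <;> exact min_le_left _ _

/-! ### Prékopa-Leindler for families with partial interpolation. -/

theorem lintegral_ne_zero_of_forall_ne_zero {α : Type*} [MeasurableSpace α] {μ : Measure α}
    [NeZero μ] {f : α → ℝ≥0∞} (hf : Measurable f) (h : ∀ x, f x ≠ 0) : ∫⁻ x, f x ∂μ ≠ 0 := by
  intro h0
  rw [lintegral_eq_zero_iff hf] at h0
  obtain ⟨x, hx⟩ := h0.exists
  exact h x hx

theorem prod_rpow_rpow {J : Type*} (s : Finset J) (C : J → ℝ≥0∞) (w : J → ℝ) {r : ℝ}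
    (hr : 0 ≤ r) (v : J → ℝ) (hv : ∀ j, v j * r = w j) :
    (∏ j ∈ s, C j ^ v j) ^ r = ∏ j ∈ s, C j ^ w j := by
  rw [← ENNReal.prod_rpow_of_nonneg hr]
  refine Finset.prod_congr rfl fun j _ => ?_
  rw [← ENNReal.rpow_mul, hv]

/-- A one-dimensional inequality of Prékopa-Leindler type for a family of functions. -/
theorem prekopaLeindler_family_real {J : Type*} [Fintype J] {w : J → ℝ} (hw : ∀ j, 0 < w j)
    (hw1 : ∑ j, w j = 1) (e : J → Prop) [DecidablePred e] {W t : ℝ}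
    (hW : ∑ j with e j, w j = W) (hW0 : 0 < W) (hW1 : W < 1) (ht0 : 0 < t) (ht1 : t < 1)
    {A B : ℝ → ℝ≥0∞} {C : J → ℝ → ℝ≥0∞} (hA : Measurable A) (hB : Measurable B)
    (hC : ∀ j, Measurable (C j)) (hC0 : ∀ j x, C j x ≠ 0)
    (h : ∀ x y, A x ^ (1 - t * W) * B y ^ (t * W)
      ≤ ∏ j, C j (if e j then (1 - t) * x + t * y else x) ^ w j) :
    (∫⁻ x, A x) ^ (1 - t * W) * (∫⁻ x, B x) ^ (t * W) ≤ ∏ j, (∫⁻ x, C j x) ^ w j := by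
  classical
  have hIC0 : ∀ j, ∫⁻ x, C j x ≠ 0 := fun j => lintegral_ne_zero_of_forall_ne_zero (hC j) (hC0 j)
  -- An infinite factor makes the right side infinite, since no other factor vanishes. Otherwise
  -- every `C j` is finite almost everywhere, which permits dividing by `G`.
  by_cases htop : ∃ j, ∫⁻ x, C j x = ∞
  · obtain ⟨j, hj⟩ := htop
    have : ∏ j, (∫⁻ x, C j x) ^ w j = ∞ := by
      rw [← Finset.mul_prod_erase _ _ (Finset.mem_univ j), hj, ENNReal.top_rpow_of_pos (hw j),
        ENNReal.top_mul]
      exact Finset.prod_ne_zero_iff.mpr fun i _ => by simp [hIC0 i, (hw i).not_gt]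
    simp [this]
  push Not at htop
  have hWc : ∑ j with ¬ e j, w j = 1 - W := by
    rw [← hw1, ← Finset.sum_filter_add_sum_filter_not Finset.univ e w, hW]; ring
  have hV : 0 < 1 - W := by linarith
  have hu : 0 < 1 - t := by linarith
  have hc : 0 < 1 - t * W := by nlinarith
  set G : ℝ → ℝ≥0∞ := fun x => ∏ j with ¬ e j, C j x ^ (w j / (1 - W)) with hG
  set K : ℝ → ℝ≥0∞ := fun x => ∏ j with e j, C j x ^ (w j / W) with hK
  -- The hypothesis reads `A(x)^(1-tW) B(y)^(tW) ≤ G(x)^(1-W) K(z)^W` with `z = (1-t)x + ty`. Moving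
  -- the `x`-dependent factor `G` to the left turns it into `D(x)^(1-t) B(y)^t ≤ K(z)`, the usual
  -- Prékopa-Leindler hypothesis. Hölder recovers `∫ A` from `∫ D` and `∫ G`, and splits `∫ G` and
  -- `∫ K` into the `∫ C j`.
  set D : ℝ → ℝ≥0∞ := fun x => (A x ^ (1 - t * W) / G x ^ (1 - W)) ^ (W * (1 - t))⁻¹ with hD
  have hGm : Measurable G := Finset.measurable_fun_prod _ fun j _ => (hC j).pow_const _
  have hKm : Measurable K := Finset.measurable_fun_prod _ fun j _ => (hC j).pow_const _
  have hDm : Measurable D := ((hA.pow_const _).div (hGm.pow_const _)).pow_const _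
  have hIG : (∫⁻ x, G x) ^ (1 - W) ≤ ∏ j with ¬ e j, (∫⁻ x, C j x) ^ w j := by
    rw [← prod_rpow_rpow _ _ w hV.le (fun j => w j / (1 - W)) fun j => div_mul_cancel₀ _ hV.ne']
    refine ENNReal.rpow_le_rpow ?_ hV.le
    exact ENNReal.lintegral_prod_norm_pow_le _ (fun j _ => (hC j).aemeasurable)
      (by rw [← Finset.sum_div, hWc, div_self hV.ne']) fun j _ => (div_pos (hw j) hV).le
  have hIK : (∫⁻ x, K x) ^ W ≤ ∏ j with e j, (∫⁻ x, C j x) ^ w j := by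
    rw [← prod_rpow_rpow _ _ w hW0.le (fun j => w j / W) fun j => div_mul_cancel₀ _ hW0.ne']
    refine ENNReal.rpow_le_rpow ?_ hW0.le
    exact ENNReal.lintegral_prod_norm_pow_le _ (fun j _ => (hC j).aemeasurable)
      (by rw [← Finset.sum_div, hW, div_self hW0.ne']) fun j _ => (div_pos (hw j) hW0).le
  have hG0 : ∀ x, G x ^ (1 - W) ≠ 0 := by
    intro x
    have : G x ≠ 0 := Finset.prod_ne_zero_iff.mpr fun i _ => by
      simp [hC0 i, (div_pos (hw i) hV).not_gt]
    simp [this, hV.not_gt]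
  have hGt : ∀ᵐ x, G x ^ (1 - W) ≠ ∞ := by
    have : ∀ᵐ x, ∀ j, C j x < ∞ := ae_all_iff.mpr fun j => ae_lt_top (hC j) (htop j)
    filter_upwards [this] with x hx
    refine ENNReal.rpow_ne_top_of_nonneg hV.le ?_
    exact ENNReal.prod_ne_top fun j _ => ENNReal.rpow_ne_top_of_nonneg (div_pos (hw j) hV).le
      (hx j).ne
  have hDK : (∫⁻ x, D x) ^ (1 - t) * (∫⁻ x, B x) ^ t ≤ ∫⁻ x, K x := by
    refine prekopaLeindler_real ht0 ht1 hDm hB hKm fun x y => ?_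
    have h1 : D x ^ (1 - t) * B y ^ t
        = (A x ^ (1 - t * W) / G x ^ (1 - W) * B y ^ (t * W)) ^ W⁻¹ := by
      rw [ENNReal.mul_rpow_of_nonneg _ _ (inv_nonneg.mpr hW0.le), ← ENNReal.rpow_mul (B y), hD,
        ← ENNReal.rpow_mul]
      congr 2 <;> field_simp
    have h2 : K ((1 - t) * x + t * y) = (K ((1 - t) * x + t * y) ^ W) ^ W⁻¹ := by
      rw [← ENNReal.rpow_mul, mul_inv_cancel₀ hW0.ne', ENNReal.rpow_one]
    rw [h1, h2]
    refine ENNReal.rpow_le_rpow ?_ (inv_nonneg.mpr hW0.le)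
    rw [ENNReal.mul_comm_div, ← mul_div_assoc]
    refine ENNReal.div_le_of_le_mul ((h x y).trans (le_of_eq ?_))
    rw [hG, hK, prod_rpow_rpow _ _ w hV.le _ fun j => div_mul_cancel₀ _ hV.ne',
      prod_rpow_rpow _ _ w hW0.le _ fun j => div_mul_cancel₀ _ hW0.ne',
      ← Finset.prod_filter_mul_prod_filter_not Finset.univ e]
    congr 1 <;> refine Finset.prod_congr rfl fun j hj => ?_ <;>
      simp [(Finset.mem_filter.mp hj).2]
  have hIA : (∫⁻ x, A x) ^ (1 - t * W) ≤ (∫⁻ x, D x) ^ (W * (1 - t)) * (∫⁻ x, G x) ^ (1 - W) := by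
    have hp : 0 ≤ W * (1 - t) / (1 - t * W) := by positivity
    have hq : 0 ≤ (1 - W) / (1 - t * W) := by positivity
    have hpq : W * (1 - t) / (1 - t * W) + (1 - W) / (1 - t * W) = 1 := by
      rw [← add_div, div_eq_one_iff_eq hc.ne']; ring
    have h1 : ∫⁻ x, A x ≤
        ∫⁻ x, D x ^ (W * (1 - t) / (1 - t * W)) * G x ^ ((1 - W) / (1 - t * W)) := by
      refine lintegral_mono_ae ?_
      filter_upwards [hGt] with x hx
      refine le_of_eq ?_
      have h2 : A x = (A x ^ (1 - t * W) / G x ^ (1 - W) * G x ^ (1 - W)) ^ (1 - t * W)⁻¹ := by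
        rw [ENNReal.div_mul_cancel (hG0 x) hx, ← ENNReal.rpow_mul, mul_inv_cancel₀ hc.ne',
          ENNReal.rpow_one]
      conv_lhs => rw [h2]
      rw [ENNReal.mul_rpow_of_nonneg _ _ (inv_nonneg.mpr hc.le), ← ENNReal.rpow_mul (G x), hD,
        ← ENNReal.rpow_mul]
      congr 2
      field_simp
    have h3 := h1.trans (ENNReal.lintegral_mul_norm_pow_le hDm.aemeasurable hGm.aemeasurable
      hp hq hpq)
    refine (ENNReal.rpow_le_rpow h3 hc.le).trans (le_of_eq ?_)
    rw [ENNReal.mul_rpow_of_nonneg _ _ hc.le, ← ENNReal.rpow_mul, ← ENNReal.rpow_mul,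
      div_mul_cancel₀ _ hc.ne', div_mul_cancel₀ _ hc.ne']
  calc (∫⁻ x, A x) ^ (1 - t * W) * (∫⁻ x, B x) ^ (t * W)
      ≤ (∫⁻ x, D x) ^ (W * (1 - t)) * (∫⁻ x, G x) ^ (1 - W) * (∫⁻ x, B x) ^ (t * W) := by gcongr
    _ = ((∫⁻ x, D x) ^ (1 - t) * (∫⁻ x, B x) ^ t) ^ W * (∫⁻ x, G x) ^ (1 - W) := by
        rw [ENNReal.mul_rpow_of_nonneg _ _ hW0.le, ← ENNReal.rpow_mul, ← ENNReal.rpow_mul,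
          mul_comm (1 - t)]
        ring
    _ ≤ (∫⁻ x, K x) ^ W * (∫⁻ x, G x) ^ (1 - W) := by gcongr
    _ ≤ (∏ j with e j, (∫⁻ x, C j x) ^ w j) * ∏ j with ¬ e j, (∫⁻ x, C j x) ^ w j := by gcongr
    _ = ∏ j, (∫⁻ x, C j x) ^ w j := Finset.prod_filter_mul_prod_filter_not Finset.univ e _

theorem lintegral_fin_succ {n : ℕ} {f : (Fin (n + 1) → ℝ) → ℝ≥0∞} (hf : Measurable f) :
    ∫⁻ x, f x = ∫⁻ x' : Fin n → ℝ, ∫⁻ s : ℝ, f (Fin.cons s x') := by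
  have h := (volume_preserving_piFinSuccAbove (fun _ : Fin (n + 1) => ℝ) 0).symm
  rw [← h.lintegral_comp hf, Measure.volume_eq_prod, lintegral_prod_symm']
  · simp [MeasurableEquiv.piFinSuccAbove_symm_apply, Fin.insertNthEquiv]
  · exact hf.comp h.measurable

theorem measurable_fin_cons {n : ℕ} :
    Measurable fun p : ℝ × (Fin n → ℝ) => (Fin.cons p.1 p.2 : Fin (n + 1) → ℝ) := by
  refine measurable_pi_lambda _ fun i => ?_
  refine Fin.cases ?_ (fun i => ?_) i
  · simpa using measurable_fst
  · simp only [Fin.cons_succ]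
    fun_prop

/-- An inequality of Prékopa-Leindler type on `ℝ^n`, in which the `j`-th function is evaluated at
a point that interpolates only the coordinates selected by `e j`. -/
theorem prekopaLeindler_family_pi {J : Type*} [Fintype J] {w : J → ℝ} (hw : ∀ j, 0 < w j)
    (hw1 : ∑ j, w j = 1) {W t : ℝ} (hW0 : 0 < W) (hW1 : W < 1) (ht0 : 0 < t) (ht1 : t < 1)
    {n : ℕ} (e : J → Fin n → Prop) [∀ j, DecidablePred (e j)]
    (hW : ∀ i, ∑ j with e j i, w j = W)
    {A B : (Fin n → ℝ) → ℝ≥0∞} {C : J → (Fin n → ℝ) → ℝ≥0∞} (hA : Measurable A)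
    (hB : Measurable B) (hC : ∀ j, Measurable (C j)) (hC0 : ∀ j x, C j x ≠ 0)
    (h : ∀ x y, A x ^ (1 - t * W) * B y ^ (t * W)
      ≤ ∏ j, C j (fun i => if e j i then (1 - t) * x i + t * y i else x i) ^ w j) :
    (∫⁻ x, A x) ^ (1 - t * W) * (∫⁻ x, B x) ^ (t * W) ≤ ∏ j, (∫⁻ x, C j x) ^ w j := by
  induction n with
  | zero =>
    have : (volume : Measure (Fin 0 → ℝ)) = Measure.dirac default := Measure.volume_pi_eq_dirac _
    simp only [lintegral_unique, this, Measure.dirac_apply_of_mem (Set.mem_univ _), mul_one]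
    refine (h _ _).trans (le_of_eq ?_)
    refine Finset.prod_congr rfl fun j _ => ?_
    congr 2
    exact Subsingleton.elim _ _
  | succ n ih =>
    have hm : ∀ f : (Fin (n + 1) → ℝ) → ℝ≥0∞, Measurable f →
        Measurable fun x' : Fin n → ℝ => ∫⁻ s : ℝ, f (Fin.cons s x') := fun f hf =>
      (hf.comp measurable_fin_cons).lintegral_prod_left'
    have hm1 : ∀ f : (Fin (n + 1) → ℝ) → ℝ≥0∞, Measurable f → ∀ x' : Fin n → ℝ,
        Measurable fun s : ℝ => f (Fin.cons s x') := fun f hf x' =>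
      (hf.comp measurable_fin_cons).comp (measurable_id.prodMk measurable_const)
    rw [lintegral_fin_succ hA, lintegral_fin_succ hB]
    simp only [fun j => lintegral_fin_succ (hC j)]
    refine ih (fun j i => e j i.succ) (fun i => hW i.succ) (hm A hA) (hm B hB)
      (fun j => hm _ (hC j))
      (fun j x => lintegral_ne_zero_of_forall_ne_zero (hm1 _ (hC j) x) fun s => hC0 j _)
      fun x' y' => ?_
    -- For fixed tails `x'` and `y'`, the one-dimensional inequality in coordinate `0` is the
    -- hypothesis that the induction needs for the partial integrals.
    refine prekopaLeindler_family_real hw hw1 (fun j => e j 0) (hW 0) hW0 hW1 ht0 ht1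
      (hm1 A hA x') (hm1 B hB y') (C := fun j s => C j (Fin.cons s
        (fun i => if e j i.succ then (1 - t) * x' i + t * y' i else x' i)))
      (fun j => hm1 _ (hC j) _) (fun j s => hC0 j _) fun x y => ?_
    refine (h (Fin.cons x x') (Fin.cons y y')).trans (le_of_eq ?_)
    refine Finset.prod_congr rfl fun j _ => ?_
    congr 2
    funext i
    refine Fin.cases ?_ (fun i => ?_) i <;> simp

/-- `prekopaLeindler_family_pi` in the coordinates of an orthonormal basis. -/
theorem prekopaLeindler_family_basis {J : Type*} [Fintype J] {w : J → ℝ} (hw : ∀ j, 0 < w j)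
    (hw1 : ∑ j, w j = 1) {W t : ℝ} (hW0 : 0 < W) (hW1 : W < 1) (ht0 : 0 < t) (ht1 : t < 1)
    {n : ℕ} (b : OrthonormalBasis (Fin n) ℝ (EuclideanSpace ℝ (Fin n)))
    (e : J → Fin n → Prop) [∀ j, DecidablePred (e j)]
    (hW : ∀ i, ∑ j with e j i, w j = W)
    {A B : EuclideanSpace ℝ (Fin n) → ℝ≥0∞} {C : J → EuclideanSpace ℝ (Fin n) → ℝ≥0∞}
    (hA : Measurable A) (hB : Measurable B) (hC : ∀ j, Measurable (C j)) (hC0 : ∀ j x, C j x ≠ 0)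
    (h : ∀ x y, A x ^ (1 - t * W) * B y ^ (t * W)
      ≤ ∏ j, C j (x + t • ∑ i with e j i, inner ℝ (b i) (y - x) • b i) ^ w j) :
    (∫⁻ x, A x) ^ (1 - t * W) * (∫⁻ x, B x) ^ (t * W) ≤ ∏ j, (∫⁻ x, C j x) ^ w j := by
  have hmp : MeasurePreserving (fun z : Fin n → ℝ => b.repr.symm (WithLp.toLp 2 z)) :=
    b.measurePreserving_repr_symm.comp (PiLp.volume_preserving_toLp (Fin n))
  rw [← hmp.lintegral_comp hA, ← hmp.lintegral_comp hB]
  simp only [← hmp.lintegral_comp (hC _)]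
  refine prekopaLeindler_family_pi hw hw1 hW0 hW1 ht0 ht1 e hW (hA.comp hmp.measurable)
    (hB.comp hmp.measurable) (fun j => (hC j).comp hmp.measurable) (fun j x => hC0 j _)
    fun x y => (h _ _).trans (le_of_eq ?_)
  refine Finset.prod_congr rfl fun j _ => ?_
  congr 2
  refine b.repr.injective ?_
  ext i
  have hs : ∀ z, b.repr (∑ k with e j k, inner ℝ (b k) z • b k) i
      = if e j i then b.repr z i else 0 := by
    intro z
    rw [b.repr_apply_apply, b.repr_apply_apply, inner_sum]
    simp [inner_smul_right, orthonormal_iff_ite.mp b.orthonormal, Finset.sum_ite_eq,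
      Finset.mem_filter]
  rw [map_add, map_smul, PiLp.add_apply, PiLp.smul_apply, hs, map_sub]
  simp only [LinearIsometryEquiv.apply_symm_apply, PiLp.sub_apply, smul_eq_mul]
  split_ifs <;> ring

/-! ### Quadratic bounds on the potential and the dual functional inequality. -/

theorem hasDerivAt_comp_line {d : ℕ} {U : EuclideanSpace ℝ (Fin d) → ℝ} (hU : Differentiable ℝ U)
    (x v : EuclideanSpace ℝ (Fin d)) (s : ℝ) :
    HasDerivAt (fun s : ℝ => U (x + s • v)) (inner ℝ (gradient U (x + s • v)) v) s := by
  have h1 := (hU (x + s • v)).hasGradientAt.hasFDerivAt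
  have h2 : HasDerivAt (fun s : ℝ => x + s • v) v s := by
    simpa using ((hasDerivAt_id s).smul_const v).const_add x
  exact (h1.comp_hasDerivAt s h2).congr_deriv (by simp)

/-- Along the segment, subtracting the affine part and `L / 2 * ‖v‖² s²` leaves a function whose
derivative is nonpositive by Cauchy-Schwarz and the Lipschitz bound. -/
theorem IsConvexSmooth.apply_add_le {d : ℕ} {U : EuclideanSpace ℝ (Fin d) → ℝ} {lam L : ℝ}
    (hU : IsConvexSmooth U lam L) (x v : EuclideanSpace ℝ (Fin d)) :
    U (x + v) ≤ U x + inner ℝ (gradient U x) v + L / 2 * ‖v‖ ^ 2 := by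
  have hderiv : ∀ s : ℝ, HasDerivAt
      (fun s : ℝ => U (x + s • v) - s * inner ℝ (gradient U x) v - L / 2 * ‖v‖ ^ 2 * s ^ 2)
      (inner ℝ (gradient U (x + s • v)) v - inner ℝ (gradient U x) v - L * ‖v‖ ^ 2 * s) s := by
    intro s
    have h := ((hasDerivAt_comp_line hU.differentiable x v s).sub
      ((hasDerivAt_id s).mul_const (inner ℝ (gradient U x) v))).sub
        (((hasDerivAt_id s).pow 2).const_mul (L / 2 * ‖v‖ ^ 2))
    refine (h.congr_deriv ?_)
    simp
    ring
  have hanti : AntitoneOn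
      (fun s : ℝ => U (x + s • v) - s * inner ℝ (gradient U x) v - L / 2 * ‖v‖ ^ 2 * s ^ 2)
      (Set.Ici 0) := by
    refine antitoneOn_of_deriv_nonpos (convex_Ici 0)
      (fun s _ => (hderiv s).continuousAt.continuousWithinAt)
      (fun s _ => (hderiv s).differentiableAt.differentiableWithinAt) fun s hs => ?_
    rw [interior_Ici, Set.mem_Ioi] at hs
    rw [(hderiv s).deriv, ← inner_sub_left]
    have h1 := real_inner_le_norm (gradient U (x + s • v) - gradient U x) v
    have h2 := hU.lipschitz_gradient (x + s • v) x
    rw [add_sub_cancel_left, norm_smul, Real.norm_of_nonneg hs.le] at h2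
    nlinarith [mul_le_mul_of_nonneg_right h2 (norm_nonneg v)]
  have := hanti (a := 0) (b := 1) (by simp) (by simp) zero_le_one
  simp only [one_smul, zero_smul, add_zero] at this
  linarith

/-- The tangent-line inequality for the convex function `U - lam / 2 * ‖·‖²`, restricted to a line.
-/
theorem IsConvexSmooth.le_apply_add {d : ℕ} {U : EuclideanSpace ℝ (Fin d) → ℝ} {lam L : ℝ}
    (hU : IsConvexSmooth U lam L) (x v : EuclideanSpace ℝ (Fin d)) :
    U x + inner ℝ (gradient U x) v + lam / 2 * ‖v‖ ^ 2 ≤ U (x + v) := by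
  have hsq : ∀ s : ℝ, ‖x + s • v‖ ^ 2 = ‖x‖ ^ 2 + 2 * s * inner ℝ x v + s ^ 2 * ‖v‖ ^ 2 := by
    intro s
    rw [norm_add_sq_real, inner_smul_right, norm_smul, mul_pow, Real.norm_eq_abs, sq_abs]
    ring
  have hconv : ConvexOn ℝ Set.univ fun s : ℝ => U (x + s • v) - lam / 2 * ‖x + s • v‖ ^ 2 := by
    have := hU.lam_convex.comp_affineMap (AffineMap.lineMap x (x + v) : ℝ →ᵃ[ℝ] _)
    simpa [Function.comp_def, AffineMap.lineMap_apply, add_comm] using this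
  have hderiv : HasDerivAt (fun s : ℝ => U (x + s • v) - lam / 2 * ‖x + s • v‖ ^ 2)
      (inner ℝ (gradient U x) v - lam * inner ℝ x v) 0 := by
    simp only [hsq]
    have h := (hasDerivAt_comp_line hU.differentiable x v 0).sub
      (((((hasDerivAt_id (0 : ℝ)).const_mul 2).mul_const (inner ℝ x v)).const_add (‖x‖ ^ 2)).add
        (((hasDerivAt_id (0 : ℝ)).pow 2).mul_const (‖v‖ ^ 2)) |>.const_mul (lam / 2))
    refine (h.congr_deriv ?_)
    simp
    ring
  have := hconv.le_slope_of_hasDerivAt (Set.mem_univ 0) (Set.mem_univ 1) zero_lt_one hderiv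
  rw [slope_def_field, hsq, hsq] at this
  simp only [one_smul, zero_smul, add_zero, sub_zero, div_one] at this
  linarith

theorem IsConvexSmooth.lam_le {d : ℕ} (hd : 0 < d) {U : EuclideanSpace ℝ (Fin d) → ℝ} {lam L : ℝ}
    (hU : IsConvexSmooth U lam L) : lam ≤ L := by
  have h1 := hU.apply_add_le 0 (EuclideanSpace.single ⟨0, hd⟩ 1)
  have h2 := hU.le_apply_add 0 (EuclideanSpace.single ⟨0, hd⟩ 1)
  simp only [PiLp.norm_single, norm_one] at h1 h2
  linarith

theorem sum_mul_sum_filter_eq {J : Type*} [Fintype J] {w : J → ℝ} {W : ℝ} {n : ℕ}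
    (e : J → Fin n → Prop) [∀ j, DecidablePred (e j)] (hW : ∀ i, ∑ j with e j i, w j = W)
    (f : Fin n → ℝ) : ∑ j, w j * ∑ i with e j i, f i = W * ∑ i, f i := by
  simp only [Finset.mul_sum, Finset.sum_filter]
  rw [Finset.sum_comm]
  refine Finset.sum_congr rfl fun i _ => ?_
  rw [← hW i, Finset.sum_filter, Finset.sum_mul]
  refine Finset.sum_congr rfl fun j _ => ?_
  split_ifs <;> simp

/-- Moving by a fraction `t ≤ lam / L` of the displacement in randomly chosen directions decreases
`U` on average as much as convexity predicts for a full move. -/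
theorem IsConvexSmooth.sum_mul_apply_le {d : ℕ} {U : EuclideanSpace ℝ (Fin d) → ℝ} {lam L : ℝ}
    (hU : IsConvexSmooth U lam L) {J : Type*} [Fintype J] {w : J → ℝ} (hw : ∀ j, 0 < w j)
    (hw1 : ∑ j, w j = 1) {W t : ℝ} (hW0 : 0 ≤ W) (ht0 : 0 < t) (ht : t * L ≤ lam)
    (b : OrthonormalBasis (Fin d) ℝ (EuclideanSpace ℝ (Fin d)))
    (e : J → Fin d → Prop) [∀ j, DecidablePred (e j)] (hW : ∀ i, ∑ j with e j i, w j = W)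
    (x y : EuclideanSpace ℝ (Fin d)) :
    ∑ j, w j * U (x + t • ∑ i with e j i, inner ℝ (b i) (y - x) • b i)
      ≤ (1 - t * W) * U x + t * W * U y := by
  set P : J → EuclideanSpace ℝ (Fin d) := fun j => ∑ i with e j i, inner ℝ (b i) (y - x) • b i
    with hP
  have hnorm : ∀ j, ‖P j‖ ^ 2 = ∑ i with e j i, inner ℝ (b i) (y - x) ^ 2 := by
    intro j
    rw [← real_inner_self_eq_norm_sq, hP]
    simp only [b.orthonormal.inner_sum]
    simp [sq]
  have hinner : ∀ j, inner ℝ (gradient U x) (P j)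
      = ∑ i with e j i, inner ℝ (b i) (y - x) * inner ℝ (gradient U x) (b i) := by
    intro j
    rw [hP]
    simp [inner_sum, inner_smul_right]
  -- On average, `P` reproduces `W` times the displacement, and `‖P‖²` reproduces `W` times its
  -- squared norm, because each direction is selected with weight `W`.
  have h1 : ∑ j, w j * inner ℝ (gradient U x) (P j) = W * inner ℝ (gradient U x) (y - x) := by
    simp only [hinner]
    rw [sum_mul_sum_filter_eq e hW, ← b.sum_inner_mul_inner]
    simp only [mul_comm]
  have h2 : ∑ j, w j * ‖P j‖ ^ 2 = W * ‖y - x‖ ^ 2 := by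
    simp only [hnorm]
    rw [sum_mul_sum_filter_eq e hW, b.sum_sq_inner_right]
  have h3 := hU.le_apply_add x (y - x)
  rw [add_sub_cancel] at h3
  calc ∑ j, w j * U (x + t • P j)
      ≤ ∑ j, (w j * U x + t * (w j * inner ℝ (gradient U x) (P j))
          + L / 2 * t ^ 2 * (w j * ‖P j‖ ^ 2)) := by
        refine Finset.sum_le_sum fun j _ => ?_
        have := mul_le_mul_of_nonneg_left (hU.apply_add_le x (t • P j)) (hw j).le
        rw [inner_smul_right, norm_smul, mul_pow, Real.norm_eq_abs, sq_abs] at this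
        linarith
    _ = U x + t * W * (inner ℝ (gradient U x) (y - x) + (t * L) / 2 * ‖y - x‖ ^ 2) := by
        rw [Finset.sum_add_distrib, Finset.sum_add_distrib, ← Finset.sum_mul, ← Finset.mul_sum,
          ← Finset.mul_sum, h1, h2, hw1]
        ring
    -- Strong convexity at `y` pays for the smoothness error exactly because `t * L ≤ lam`.
    _ ≤ U x + t * W * (U y - U x) := by
        gcongr
        nlinarith [sq_nonneg ‖y - x‖]
    _ = (1 - t * W) * U x + t * W * U y := by ring

theorem lintegral_gibbsMeasure {d : ℕ} {U : EuclideanSpace ℝ (Fin d) → ℝ} (hU : Measurable U)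
    {f : EuclideanSpace ℝ (Fin d) → ℝ} (hf : Measurable f) :
    ∫⁻ x, ENNReal.ofReal (Real.exp (f x)) ∂(gibbsMeasure U)
      = ∫⁻ x, ENNReal.ofReal (Real.exp (f x - U x)) := by
  rw [gibbsMeasure, lintegral_withDensity_eq_lintegral_mul _ (by fun_prop) (by fun_prop)]
  refine lintegral_congr fun x => ?_
  rw [Pi.mul_apply, ← ENNReal.ofReal_mul (Real.exp_pos _).le, ← Real.exp_add]
  congr 2
  ring

/-- A functional inequality dual to the contraction of relative entropy. -/
theorem IsConvexSmooth.lintegral_exp_rpow_le {d : ℕ} {U : EuclideanSpace ℝ (Fin d) → ℝ}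
    {lam L : ℝ} (hU : IsConvexSmooth U lam L) [IsProbabilityMeasure (gibbsMeasure U)]
    {J : Type*} [Fintype J] {w : J → ℝ}
    (hw : ∀ j, 0 < w j) (hw1 : ∑ j, w j = 1) {W t : ℝ} (hW0 : 0 < W) (hW1 : W < 1) (ht0 : 0 < t)
    (ht1 : t < 1) (ht : t * L ≤ lam) (b : OrthonormalBasis (Fin d) ℝ (EuclideanSpace ℝ (Fin d)))
    (e : J → Fin d → Prop) [∀ j, DecidablePred (e j)] (hW : ∀ i, ∑ j with e j i, w j = W)
    {g : J → EuclideanSpace ℝ (Fin d) → ℝ} (hg : ∀ j, Measurable (g j))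
    (hge : ∀ j x y, g j (x + ∑ i with e j i, inner ℝ (b i) y • b i) = g j x) :
    (∫⁻ x, ENNReal.ofReal (Real.exp ((1 - t * W)⁻¹ * ∑ j, w j * g j x)) ∂(gibbsMeasure U))
        ^ (1 - t * W)
      ≤ ∏ j, (∫⁻ x, ENNReal.ofReal (Real.exp (g j x)) ∂(gibbsMeasure U)) ^ w j := by
  have hUm : Measurable U := hU.differentiable.continuous.measurable
  have hc : 0 < 1 - t * W := by nlinarith
  have hprob : ∫⁻ x, ENNReal.ofReal (Real.exp (-U x)) = 1 := by
    have := measure_univ (μ := gibbsMeasure U)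
    rwa [gibbsMeasure, withDensity_apply _ MeasurableSet.univ, setLIntegral_univ] at this
  rw [lintegral_gibbsMeasure hUm (by fun_prop)]
  simp only [lintegral_gibbsMeasure hUm (hg _)]
  -- The function `B` is the density of `π` itself, so its integral is `1` and its factor
  -- disappears.
  have := prekopaLeindler_family_basis hw hw1 hW0 hW1 ht0 ht1 b e hW
    (A := fun x => ENNReal.ofReal (Real.exp ((1 - t * W)⁻¹ * ∑ j, w j * g j x - U x)))
    (B := fun x => ENNReal.ofReal (Real.exp (-U x)))
    (C := fun j x => ENNReal.ofReal (Real.exp (g j x - U x)))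
    (by fun_prop) (by fun_prop) (by fun_prop) (fun j x => by simp [Real.exp_pos]) ?_
  · rwa [hprob, ENNReal.one_rpow, mul_one] at this
  · intro x y
    simp only [ENNReal.ofReal_rpow_of_pos (Real.exp_pos _), ← Real.exp_mul]
    rw [← ENNReal.ofReal_mul (Real.exp_pos _).le, ← Real.exp_add,
      ← ENNReal.ofReal_prod_of_nonneg fun j _ => (Real.exp_pos _).le, ← Real.exp_sum]
    refine ENNReal.ofReal_le_ofReal (Real.exp_le_exp.mpr ?_)
    have hgx : ∀ j, g j (x + t • ∑ i with e j i, inner ℝ (b i) (y - x) • b i) = g j x := by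
      intro j
      rw [← hge j x (t • (y - x))]
      simp only [inner_smul_right, mul_smul, Finset.smul_sum]
    have hs := hU.sum_mul_apply_le hw hw1 hW0.le ht0 ht b e hW x y
    have e1 : ((1 - t * W)⁻¹ * ∑ j, w j * g j x - U x) * (1 - t * W)
        = ∑ j, w j * g j x - (1 - t * W) * U x := by
      field_simp
    have e2 : ∑ j, (g j (x + t • ∑ i with e j i, inner ℝ (b i) (y - x) • b i)
          - U (x + t • ∑ i with e j i, inner ℝ (b i) (y - x) • b i)) * w j
        = ∑ j, w j * g j x
          - ∑ j, w j * U (x + t • ∑ i with e j i, inner ℝ (b i) (y - x) • b i) := by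
      rw [← Finset.sum_sub_distrib]
      refine Finset.sum_congr rfl fun j _ => ?_
      rw [hgx j]
      ring
    rw [e1, e2]
    linarith

/-! ### Variational formula for relative entropy. -/

/-- The Gibbs variational principle for bounded functions. -/
theorem integral_le_toReal_klDiv_add_log {α : Type*} [MeasurableSpace α] {μ ν : Measure α}
    [IsProbabilityMeasure μ] [IsProbabilityMeasure ν] (hKL : klDiv μ ν ≠ ∞) {g : α → ℝ}
    (hg : Measurable g) {M : ℝ} (hM : ∀ x, |g x| ≤ M) :
    ∫ x, g x ∂μ ≤ (klDiv μ ν).toReal + Real.log (∫ x, Real.exp (g x) ∂ν) := by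
  obtain ⟨hac, hint⟩ := klDiv_ne_top_iff.mp hKL
  have hgμ : Integrable g μ := Integrable.of_bound hg.aestronglyMeasurable M (.of_forall hM)
  have hgν : Integrable (fun x => Real.exp (g x)) ν :=
    Integrable.of_bound (by fun_prop) (Real.exp M) (by
      simpa using Filter.Eventually.of_forall fun x => (abs_le.mp (hM x)).2)
  -- The inequality is the nonnegativity of the entropy of `μ` relative to the tilted measure
  -- `ν.tilted g`.
  have : IsProbabilityMeasure (ν.tilted g) := isProbabilityMeasure_tilted hgν
  have h1 := integral_llr_tilted_right hac hgμ hgν hint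
  have h2 := integral_llr_add_sub_measure_univ_nonneg
    (hac.trans (absolutelyContinuous_tilted hgν)) (integrable_llr_tilted_right hac hgμ hint hgν)
  have h3 := toReal_klDiv_of_measure_eq hac (by simp)
  simp only [probReal_univ] at h2
  linarith

/-- Bounded functions that are asymptotically optimal in the variational formula for the relative
entropy. -/
theorem exists_seq_tendsto_toReal_klDiv {α : Type*} [MeasurableSpace α] {μ ν : Measure α}
    [IsProbabilityMeasure μ] [IsProbabilityMeasure ν] (hKL : klDiv μ ν ≠ ∞) :
    ∃ g : ℕ → α → ℝ, (∀ n, Measurable (g n)) ∧ (∀ n x, |g n x| ≤ n) ∧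
      Filter.Tendsto (fun n => ∫ x, g n x ∂μ) Filter.atTop (nhds (klDiv μ ν).toReal) ∧
      Filter.Tendsto (fun n => ∫ x, Real.exp (g n x) ∂ν) Filter.atTop (nhds 1) := by
  obtain ⟨hac, hint⟩ := klDiv_ne_top_iff.mp hKL
  set F : α → ℝ := fun x => (μ.rnDeriv ν x).toReal with hF
  have hFm : Measurable F := (Measure.measurable_rnDeriv μ ν).ennreal_toReal
  have hF0 : ∀ x, 0 ≤ F x := fun x => ENNReal.toReal_nonneg
  -- The optimiser `log (dμ/dν)` is made bounded by clipping the density to `[exp (-n), exp n]`.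
  -- This interval contains `1`, so clipping can only bring the logarithm closer to `0`; hence `|llr
  -- μ ν|` dominates.
  set c : ℕ → α → ℝ := fun n x => max (Real.exp (-n)) (min (Real.exp n) (F x)) with hc
  have hcm : ∀ n, Measurable (c n) := fun n => by fun_prop
  have hc0 : ∀ n x, 0 < c n x := fun n x => lt_max_of_lt_left (Real.exp_pos _)
  have hlim : ∀ x, Filter.Tendsto (fun n => c n x) Filter.atTop (nhds (F x)) := by
    intro x
    have h1 : Filter.Tendsto (fun n : ℕ => Real.exp (-n)) Filter.atTop (nhds 0) :=
      Real.tendsto_exp_neg_atTop_nhds_zero.comp tendsto_natCast_atTop_atTop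
    have h2 : Filter.Tendsto (fun n : ℕ => min (Real.exp n) (F x)) Filter.atTop (nhds (F x)) := by
      refine tendsto_const_nhds.congr' ?_
      filter_upwards [(Real.tendsto_exp_atTop.comp
        tendsto_natCast_atTop_atTop).eventually_ge_atTop (F x)] with n hn
      exact (min_eq_right hn).symm
    simpa [hF0 x] using h1.max h2
  have hle : ∀ (n : ℕ) x, |Real.log (c n x)| ≤ n := by
    intro n x
    have hn : (0 : ℝ) ≤ n := n.cast_nonneg
    rw [abs_le, ← Real.log_exp (-n : ℝ)]
    refine ⟨Real.log_le_log (Real.exp_pos _) (le_max_left _ _), ?_⟩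
    rw [← Real.log_exp (n : ℝ)]
    refine Real.log_le_log (hc0 n x) (max_le (Real.exp_le_exp.mpr ?_) (min_le_left _ _))
    linarith
  have hpos : ∀ᵐ x ∂μ, 0 < F x := by
    filter_upwards [Measure.rnDeriv_pos hac, hac.ae_le (Measure.rnDeriv_lt_top μ ν)] with x h1 h2
    exact ENNReal.toReal_pos h1.ne' h2.ne
  refine ⟨fun n x => Real.log (c n x), fun n => (hcm n).log, hle, ?_, ?_⟩
  · rw [toReal_klDiv_of_measure_eq hac (by simp)]
    refine tendsto_integral_of_dominated_convergence (fun x => |llr μ ν x|)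
      (fun n => (hcm n).log.aestronglyMeasurable) hint.abs (fun n => ?_) ?_
    · filter_upwards [hpos] with x hx
      have hn : (0 : ℝ) ≤ n := n.cast_nonneg
      have h1 : Real.exp (-n) ≤ 1 := Real.exp_le_one_iff.mpr (by linarith)
      have h2 : 1 ≤ Real.exp n := Real.one_le_exp hn
      rw [Real.norm_eq_abs]
      change _ ≤ |Real.log (F x)|
      rcases le_total 1 (F x) with h | h
      · have e : c n x = min (Real.exp n) (F x) :=
          max_eq_right (h1.trans (le_min h2 h))
        have : 1 ≤ c n x := e ▸ le_min h2 h
        rw [abs_of_nonneg (Real.log_nonneg this), abs_of_nonneg (Real.log_nonneg h)]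
        exact Real.log_le_log (hc0 n x) (e ▸ min_le_right _ _)
      · have e : c n x = max (Real.exp (-n)) (F x) := by
          rw [hc]; dsimp only; rw [min_eq_right (h.trans h2)]
        have : c n x ≤ 1 := e ▸ max_le h1 h
        rw [abs_of_nonpos (Real.log_nonpos (hc0 n x).le this),
          abs_of_nonpos (Real.log_nonpos hx.le h)]
        exact neg_le_neg (Real.log_le_log hx (e ▸ le_max_right _ _))
    · filter_upwards [hpos] with x hx
      exact (hlim x).log hx.ne'
  · simp only [Real.exp_log (hc0 _ _)]
    have h1 : ∫ x, F x ∂ν = 1 := by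
      rw [hF, Measure.integral_toReal_rnDeriv hac, probReal_univ]
    rw [← h1]
    refine tendsto_integral_of_dominated_convergence (fun x => 1 + F x)
      (fun n => (hcm n).aestronglyMeasurable)
      ((integrable_const 1).add Measure.integrable_toReal_rnDeriv) (fun n => ?_)
      (Filter.Eventually.of_forall hlim)
    refine Filter.Eventually.of_forall fun x => ?_
    have hn : (0 : ℝ) ≤ n := n.cast_nonneg
    have h1 : Real.exp (-n) ≤ 1 := Real.exp_le_one_iff.mpr (by linarith)
    rw [Real.norm_of_nonneg (hc0 n x).le]
    exact max_le (by linarith [hF0 x]) ((min_le_right _ _).trans (by linarith))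

/-! ### Entropy contraction along a fixed basis. -/

/-- The Gibbs principle for `h = (1 - t W)⁻¹ ∑ w_j g_j`, multiplied by `1 - t W`, combined with the
logarithm of the dual functional inequality. -/
theorem IsConvexSmooth.sum_integral_le {d : ℕ} {U : EuclideanSpace ℝ (Fin d) → ℝ}
    {lam L : ℝ} (hU : IsConvexSmooth U lam L) [IsProbabilityMeasure (gibbsMeasure U)]
    {μ : Measure (EuclideanSpace ℝ (Fin d))} [IsProbabilityMeasure μ]
    (hKL : klDiv μ (gibbsMeasure U) ≠ ∞)
    {J : Type*} [Fintype J] {w : J → ℝ}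
    (hw : ∀ j, 0 < w j) (hw1 : ∑ j, w j = 1) {W t : ℝ} (hW0 : 0 < W) (hW1 : W < 1) (ht0 : 0 < t)
    (ht1 : t < 1) (ht : t * L ≤ lam) (b : OrthonormalBasis (Fin d) ℝ (EuclideanSpace ℝ (Fin d)))
    (e : J → Fin d → Prop) [∀ j, DecidablePred (e j)] (hW : ∀ i, ∑ j with e j i, w j = W)
    {g : J → EuclideanSpace ℝ (Fin d) → ℝ} (hg : ∀ j, Measurable (g j)) {M : ℝ}
    (hM : ∀ j x, |g j x| ≤ M)
    (hge : ∀ j x y, g j (x + ∑ i with e j i, inner ℝ (b i) y • b i) = g j x) :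
    ∑ j, w j * ∫ x, g j x ∂μ ≤ (1 - t * W) * (klDiv μ (gibbsMeasure U)).toReal
      + ∑ j, w j * Real.log (∫ x, Real.exp (g j x) ∂(gibbsMeasure U)) := by
  have hc : 0 < 1 - t * W := by nlinarith
  set h : EuclideanSpace ℝ (Fin d) → ℝ := fun x => (1 - t * W)⁻¹ * ∑ j, w j * g j x with hh
  have hhm : Measurable h := by fun_prop
  have hhM : ∀ x, |h x| ≤ (1 - t * W)⁻¹ * M := by
    intro x
    rw [hh, abs_mul, abs_of_pos (inv_pos.mpr hc)]
    refine mul_le_mul_of_nonneg_left ?_ (inv_pos.mpr hc).le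
    calc |∑ j, w j * g j x| ≤ ∑ j, |w j * g j x| := Finset.abs_sum_le_sum_abs _ _
      _ ≤ ∑ j, w j * M := Finset.sum_le_sum fun j _ => by
          rw [abs_mul, abs_of_pos (hw j)]
          exact mul_le_mul_of_nonneg_left (hM j x) (hw j).le
      _ = M := by rw [← Finset.sum_mul, hw1, one_mul]
  have hexp : ∀ (f : EuclideanSpace ℝ (Fin d) → ℝ) (N : ℝ), Measurable f → (∀ x, |f x| ≤ N) →
      Integrable (fun x => Real.exp (f x)) (gibbsMeasure U) := fun f N hf hN =>
    Integrable.of_bound (by fun_prop) (Real.exp N) (by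
      simpa using Filter.Eventually.of_forall fun x => (abs_le.mp (hN x)).2)
  have hpos : ∀ (f : EuclideanSpace ℝ (Fin d) → ℝ) (N : ℝ), Measurable f → (∀ x, |f x| ≤ N) →
      0 < ∫ x, Real.exp (f x) ∂(gibbsMeasure U) := fun f N hf hN =>
    integral_exp_pos (hexp f N hf hN)
  have hlin : ∀ (f : EuclideanSpace ℝ (Fin d) → ℝ) (N : ℝ), Measurable f → (∀ x, |f x| ≤ N) →
      ∫⁻ x, ENNReal.ofReal (Real.exp (f x)) ∂(gibbsMeasure U)
        = ENNReal.ofReal (∫ x, Real.exp (f x) ∂(gibbsMeasure U)) := fun f N hf hN =>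
    (ofReal_integral_eq_lintegral_ofReal (hexp f N hf hN)
      (Filter.Eventually.of_forall fun x => (Real.exp_pos _).le)).symm
  have key := hU.lintegral_exp_rpow_le hw hw1 hW0 hW1 ht0 ht1 ht b e hW hg hge
  have key' : (1 - t * W) * Real.log (∫ x, Real.exp (h x) ∂(gibbsMeasure U))
      ≤ ∑ j, w j * Real.log (∫ x, Real.exp (g j x) ∂(gibbsMeasure U)) := by
    rw [hlin h _ hhm hhM, ENNReal.ofReal_rpow_of_pos (hpos h _ hhm hhM)] at key
    simp only [fun j => hlin (g j) M (hg j) (hM j),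
      fun j => ENNReal.ofReal_rpow_of_pos (p := w j) (hpos (g j) M (hg j) (hM j))] at key
    have hp : ∀ j, 0 < (∫ x, Real.exp (g j x) ∂(gibbsMeasure U)) ^ w j := fun j =>
      Real.rpow_pos_of_pos (hpos (g j) M (hg j) (hM j)) _
    rw [← ENNReal.ofReal_prod_of_nonneg fun j _ => (hp j).le,
      ENNReal.ofReal_le_ofReal_iff (Finset.prod_nonneg fun j _ => (hp j).le)] at key
    have := Real.log_le_log (Real.rpow_pos_of_pos (hpos h _ hhm hhM) _) key
    rw [Real.log_rpow (hpos h _ hhm hhM), Real.log_prod fun j _ => (hp j).ne'] at this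
    simpa only [fun j => Real.log_rpow (hpos (g j) M (hg j) (hM j)) (w j)] using this
  have hdv := integral_le_toReal_klDiv_add_log hKL hhm hhM
  have hint : ∀ j, Integrable (g j) μ := fun j =>
    Integrable.of_bound (hg j).aestronglyMeasurable M (.of_forall (hM j))
  have hsum : (1 - t * W) * ∫ x, h x ∂μ = ∑ j, w j * ∫ x, g j x ∂μ := by
    rw [hh, integral_const_mul, mul_inv_cancel_left₀ hc.ne',
      integral_finsetSum _ fun j _ => (hint j).const_mul _]
    simp only [integral_const_mul]
  rw [← hsum]
  have := mul_le_mul_of_nonneg_left hdv hc.le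
  linarith

/-- Contraction of relative entropy under averages of projections along a fixed orthonormal
basis. -/
theorem IsConvexSmooth.sum_toReal_klDiv_map_le {d : ℕ} {U : EuclideanSpace ℝ (Fin d) → ℝ}
    {lam L : ℝ} (hd : 0 < d) (hU : IsConvexSmooth U lam L) [IsProbabilityMeasure (gibbsMeasure U)]
    {μ : Measure (EuclideanSpace ℝ (Fin d))} [IsProbabilityMeasure μ]
    (hKL : klDiv μ (gibbsMeasure U) ≠ ∞)
    {J : Type*} [Fintype J] {w : J → ℝ}
    (hw : ∀ j, 0 < w j) (hw1 : ∑ j, w j = 1) {W : ℝ} (hW0 : 0 < W) (hW1 : W < 1)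
    (b : OrthonormalBasis (Fin d) ℝ (EuclideanSpace ℝ (Fin d)))
    (e : J → Fin d → Prop) [∀ j, DecidablePred (e j)] (hW : ∀ i, ∑ j with e j i, w j = W)
    {p : J → EuclideanSpace ℝ (Fin d) → EuclideanSpace ℝ (Fin d)} (hp : ∀ j, Measurable (p j))
    (hpe : ∀ j x y, p j (x + ∑ i with e j i, inner ℝ (b i) y • b i) = p j x) :
    ∑ j, w j * (klDiv (μ.map (p j)) ((gibbsMeasure U).map (p j))).toReal
      ≤ (1 - lam / L * W) * (klDiv μ (gibbsMeasure U)).toReal := by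
  have hL : lam ≤ L := hU.lam_le hd
  have hL0 : 0 < L := hU.lam_pos.trans_le hL
  have hμp : ∀ j, IsProbabilityMeasure (μ.map (p j)) := fun j =>
    Measure.isProbabilityMeasure_map (hp j).aemeasurable
  have hπp : ∀ j, IsProbabilityMeasure ((gibbsMeasure U).map (p j)) := fun j =>
    Measure.isProbabilityMeasure_map (hp j).aemeasurable
  choose g hgm hgb hgμ hgπ using fun j => exists_seq_tendsto_toReal_klDiv
    (ne_top_of_le_ne_top hKL (klDiv_map_le μ (gibbsMeasure U) (hp j)))
  -- Prékopa-Leindler needs `t < 1`, while `lam / L` may equal `1`; the endpoint is reached as a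
  -- limit. The test functions are near-optimal ones composed with `p j`, hence invariant in the
  -- ignored directions.
  have hstep : ∀ t : ℝ, 0 < t → t < lam / L →
      ∑ j, w j * (klDiv (μ.map (p j)) ((gibbsMeasure U).map (p j))).toReal
        ≤ (1 - t * W) * (klDiv μ (gibbsMeasure U)).toReal := by
    intro t ht0 ht
    have ht1 : t < 1 := ht.trans_le ((div_le_one hL0).mpr hL)
    have htL : t * L ≤ lam := ((lt_div_iff₀ hL0).mp ht).le
    have h1 := fun n => hU.sum_integral_le hKL hw hw1 hW0 hW1 ht0 ht1 htL b e hW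
      (g := fun j x => g j n (p j x)) (fun j => (hgm j n).comp (hp j)) (M := n)
      (fun j x => hgb j n _) (fun j x y => by rw [hpe])
    have h2 : ∀ n j, ∫ x, g j n (p j x) ∂μ = ∫ x, g j n x ∂(μ.map (p j)) := fun n j =>
      (integral_map (hp j).aemeasurable (hgm j n).aestronglyMeasurable).symm
    have h3 : ∀ n j, ∫ x, Real.exp (g j n (p j x)) ∂(gibbsMeasure U)
        = ∫ x, Real.exp (g j n x) ∂((gibbsMeasure U).map (p j)) := fun n j =>
      (integral_map (f := fun x => Real.exp (g j n x)) (hp j).aemeasurable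
        (hgm j n).exp.aestronglyMeasurable).symm
    simp only [h2, h3] at h1
    refine le_of_tendsto_of_tendsto'
      (tendsto_finsetSum _ fun j _ => (hgμ j).const_mul (w j)) ?_ h1
    have h4 := tendsto_finsetSum (Finset.univ : Finset J) fun j _ =>
      ((hgπ j).log one_ne_zero).const_mul (w j)
    simpa using h4.const_add ((1 - t * W) * (klDiv μ (gibbsMeasure U)).toReal)
  have hlim : Filter.Tendsto (fun t => (1 - t * W) * (klDiv μ (gibbsMeasure U)).toReal)
      (nhdsWithin (lam / L) (Set.Iio (lam / L)))
      (nhds ((1 - lam / L * W) * (klDiv μ (gibbsMeasure U)).toReal)) :=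
    (Continuous.tendsto (by fun_prop) _).mono_left nhdsWithin_le_nhds
  refine ge_of_tendsto hlim ?_
  filter_upwards [Ioo_mem_nhdsLT (div_pos hU.lam_pos hL0)] with t ht
  exact hstep t ht.1 ht.2

/-! ### Measurable dependence on the frame. -/

/-- On a countably generated space, the Radon-Nikodym derivative of two kernels has a jointly
measurable version, and absolute continuity is a measurable condition on the parameter. -/
theorem measurable_klDiv_kernel {α γ : Type*} [MeasurableSpace α] [MeasurableSpace γ]
    [MeasurableSpace.CountablyGenerated γ] (κ η : Kernel α γ) [IsFiniteKernel κ]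
    [IsFiniteKernel η] : Measurable fun a => klDiv (κ a) (η a) := by
  classical
  have h : (fun a => klDiv (κ a) (η a)) = fun a => if κ a ≪ η a then
      ∫⁻ x, ENNReal.ofReal (klFun (κ.rnDeriv η a x).toReal) ∂(η a) else ∞ := by
    funext a
    rw [klDiv_eq_lintegral_klFun]
    congr 1
    refine lintegral_congr_ae ?_
    filter_upwards [Kernel.rnDeriv_eq_rnDeriv_measure (κ := κ) (η := η) (a := a)] with x hx
    rw [hx]
  rw [h]
  refine Measurable.ite (Kernel.measurableSet_absolutelyContinuous κ η) ?_ measurable_const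
  refine Measurable.lintegral_kernel_prod_right'
    (f := fun p : α × γ => ENNReal.ofReal (klFun (κ.rnDeriv η p.1 p.2).toReal)) ?_
  exact (measurable_klFun.comp (Kernel.measurable_rnDeriv κ η).ennreal_toReal).ennreal_ofReal

theorem measurable_klDiv_map {α β γ : Type*} [MeasurableSpace α] [MeasurableSpace β]
    [MeasurableSpace γ] [MeasurableSpace.CountablyGenerated γ] (μ ν : Measure β)
    [IsFiniteMeasure μ] [IsFiniteMeasure ν] {p : α → β → γ} (hp : Measurable (Function.uncurry p)) :
    Measurable fun a => klDiv (μ.map (p a)) (ν.map (p a)) := by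
  -- The image measures form a kernel: `ρ.map (p a)` is the image of `δ_a ⊗ ρ` under the jointly
  -- measurable map.
  have h : ∀ (ρ : Measure β) [IsFiniteMeasure ρ] (a : α),
      ((Kernel.id ×ₖ Kernel.const α ρ).map (Function.uncurry p)) a = ρ.map (p a) := by
    intro ρ _ a
    rw [Kernel.map_apply _ hp, Kernel.prod_apply, Kernel.id_apply, Kernel.const_apply,
      Measure.dirac_prod, Measure.map_map hp (by fun_prop)]
    rfl
  have := measurable_klDiv_kernel ((Kernel.id ×ₖ Kernel.const α μ).map (Function.uncurry p))
    ((Kernel.id ×ₖ Kernel.const α ν).map (Function.uncurry p))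
  simpa only [h] using this

theorem frameProj_eq_sum {l d : ℕ} (v : Stiefel l d) (x : EuclideanSpace ℝ (Fin d)) :
    frameProj v x = ∑ i, inner ℝ (v.1 i) x • v.1 i := by
  unfold frameProj
  refine Submodule.eq_starProjection_of_mem_of_inner_eq_zero ?_ fun z hz => ?_
  · exact Submodule.sum_mem _ fun i _ => Submodule.smul_mem _ _ (Submodule.subset_span ⟨i, rfl⟩)
  · induction hz using Submodule.span_induction with
    | mem z hz =>
      obtain ⟨k, rfl⟩ := hz
      rw [inner_sub_left, sum_inner]
      simp [inner_smul_left, orthonormal_iff_ite.mp v.2, real_inner_comm]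
    | zero => simp
    | add z z' _ _ h h' => rw [inner_add_right, h, h', add_zero]
    | smul a z _ h => rw [inner_smul_right, h, mul_zero]

theorem measurable_uncurry_frameProj {l d : ℕ} :
    Measurable (Function.uncurry (frameProj : Stiefel l d → _)) := by
  have : Function.uncurry (frameProj : Stiefel l d → _)
      = fun q : Stiefel l d × EuclideanSpace ℝ (Fin d) =>
        ∑ i, inner ℝ (q.1.1 i) q.2 • q.1.1 i := by
    funext q
    exact frameProj_eq_sum q.1 q.2
  rw [this]
  refine Finset.measurable_fun_sum _ fun i _ => ?_
  have hv : Measurable fun q : Stiefel l d × EuclideanSpace ℝ (Fin d) => q.1.1 i :=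
    (measurable_pi_apply i).comp (measurable_subtype_coe.comp measurable_fst)
  exact (Measurable.inner (𝕜 := ℝ) hv measurable_snd).smul hv

theorem measurable_frameProj {l d : ℕ} (v : Stiefel l d) : Measurable (frameProj v) :=
  (Submodule.span ℝ (Set.range v.1)).starProjection.continuous.measurable

/-! ### From a fixed basis to Haar-distributed frames. -/

/-- A right translate is again a Haar probability measure, and that measure is unique. Right
invariance is what matters here because permuting columns is right multiplication. -/
theorem map_mul_right_haarOrth {d : ℕ} (Q : OrthGroup d) :
    (haarOrth d).map (fun R => R * Q) = haarOrth d := by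
  have : (haarOrth d).IsHaarMeasure := by unfold haarOrth; infer_instance
  have h2 : ((haarOrth d).map (fun R => R * Q)).IsHaarMeasure :=
    Measure.isHaarMeasure_map_mul_right _ Q
  have h1 : IsProbabilityMeasure ((haarOrth d).map (fun R => R * Q)) :=
    Measure.isProbabilityMeasure_map (measurable_mul_const Q).aemeasurable
  exact Measure.isHaarMeasure_eq_of_isProbabilityMeasure _ _

/-- The permutation matrix whose `i`-th column is the basis vector with index `s i`. -/
def permOrth {d : ℕ} (s : Equiv.Perm (Fin d)) : OrthGroup d :=
  ⟨(1 : Matrix (Fin d) (Fin d) ℝ).submatrix id s, by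
    rw [Matrix.mem_orthogonalGroup_iff', Matrix.transpose_submatrix, Matrix.transpose_one]
    have := Matrix.submatrix_mul_equiv (1 : Matrix (Fin d) (Fin d) ℝ) 1 s (Equiv.refl _) s
    simpa using this⟩

/-- The orthonormal basis made of the columns of an orthogonal matrix. -/
noncomputable def columnBasis {d : ℕ} (R : OrthGroup d) :
    OrthonormalBasis (Fin d) ℝ (EuclideanSpace ℝ (Fin d)) :=
  OrthonormalBasis.mk (frameOf le_rfl R).2
    ((frameOf le_rfl R).2.linearIndependent.span_eq_top_of_card_eq_finrank' (by simp)).ge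

theorem frameOf_mul_permOrth {l d : ℕ} (h : l ≤ d) (R : OrthGroup d) (s : Equiv.Perm (Fin d))
    (k : Fin l) : (frameOf h (R * permOrth s)).1 k = columnBasis R (s (Fin.castLE h k)) := by
  ext i
  simp [frameOf, columnBasis, permOrth, Matrix.mul_apply, Matrix.one_apply]

/-- Each column permutation leaves the integral unchanged, so it may be averaged over permutations
first. It then suffices to bound that average for each fixed orthogonal matrix, that is, for a fixed
basis. -/
theorem lintegral_stiefelUniform_le {l d : ℕ} (h : l ≤ d) {J : Type*} [Fintype J] {w : J → ℝ≥0∞}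
    (hw : ∑ j, w j = 1) (s : J → Equiv.Perm (Fin d)) {F : Stiefel l d → ℝ≥0∞} (hF : Measurable F)
    {C : ℝ≥0∞} (hC : ∀ R, ∑ j, w j * F (frameOf h (R * permOrth (s j))) ≤ C) :
    ∫⁻ v, F v ∂(stiefelUniform h) ≤ C := by
  have hm : Measurable fun R => F (frameOf h R) := hF.comp (continuous_frameOf h).measurable
  have hj : ∀ j, ∫⁻ v, F v ∂(stiefelUniform h)
      = ∫⁻ R, F (frameOf h (R * permOrth (s j))) ∂(haarOrth d) := by
    intro j
    rw [stiefelUniform, lintegral_map hF (continuous_frameOf h).measurable]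
    conv_lhs => rw [← map_mul_right_haarOrth (permOrth (s j))]
    rw [lintegral_map hm (measurable_mul_const _)]
  calc ∫⁻ v, F v ∂(stiefelUniform h) = ∑ j, w j * ∫⁻ v, F v ∂(stiefelUniform h) := by
        rw [← Finset.sum_mul, hw, one_mul]
    _ = ∑ j, w j * ∫⁻ R, F (frameOf h (R * permOrth (s j))) ∂(haarOrth d) := by
        simp only [← hj]
    _ = ∫⁻ R, ∑ j, w j * F (frameOf h (R * permOrth (s j))) ∂(haarOrth d) := by
        rw [lintegral_finsetSum]
        · refine Finset.sum_congr rfl fun j _ => ?_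
          rw [lintegral_const_mul]
          exact hm.comp (measurable_mul_const _)
        · exact fun j _ => (hm.comp (measurable_mul_const _)).const_mul _
    _ ≤ ∫⁻ _, C ∂(haarOrth d) := lintegral_mono hC
    _ = C := by simp

/-- Window `j` consists of the indices `j, …, j + l - 1` modulo `d`, so `l ≤ (i - j).val` says that
`i` lies outside it. As `j` varies, `i - j` takes each residue once. -/
theorem card_filter_le_val_sub {l d : ℕ} [NeZero d] (h : l ≤ d) (i : Fin d) :
    (Finset.univ.filter fun j : Fin d => l ≤ (i - j).val).card = d - l := by
  have h1 : (Finset.univ.filter fun j : Fin d => l ≤ (i - j).val).card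
      = (Finset.univ.filter fun m : Fin d => l ≤ m.val).card :=
    Finset.card_equiv (Equiv.subLeft i) (by simp)
  have h2 : (Finset.univ.filter fun m : Fin d => m.val < l).card = l := by
    rw [Fin.card_filter_val_lt, min_eq_right h]
  have h3 := Finset.card_filter_add_card_filter_not (s := (Finset.univ : Finset (Fin d)))
    (fun m : Fin d => m.val < l)
  simp only [not_lt, Finset.card_univ, Fintype.card_fin] at h3
  omega

/-- Contraction of relative entropy under random orthogonal projections. -/
theorem IsConvexSmooth.lintegral_klDiv_map_frameProj_le {d l : ℕ} (hl1 : 1 ≤ l) (hld : l ≤ d)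
    {U : EuclideanSpace ℝ (Fin d) → ℝ} {lam L : ℝ} (hU : IsConvexSmooth U lam L)
    [IsProbabilityMeasure (gibbsMeasure U)]
    (μ : Measure (EuclideanSpace ℝ (Fin d))) [IsProbabilityMeasure μ] :
    ∫⁻ v : Stiefel l d, klDiv (μ.map (frameProj v)) ((gibbsMeasure U).map (frameProj v))
        ∂(stiefelUniform hld)
      ≤ ENNReal.ofReal (1 - ((d : ℝ) - (l : ℝ)) / ((L / lam) * (d : ℝ)))
        * klDiv μ (gibbsMeasure U) := by
  have hd : 0 < d := hl1.trans hld
  have : NeZero d := ⟨hd.ne'⟩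
  have hd' : (0 : ℝ) < d := by exact_mod_cast hd
  have hl' : (1 : ℝ) ≤ l := by exact_mod_cast hl1
  have hLlam : lam ≤ L := hU.lam_le hd
  have hlam := hU.lam_pos
  have hL0 : 0 < L := hlam.trans_le hLlam
  -- For `l = d` the weight `W` would be `0`; there the constant is `1` and data processing
  -- suffices.
  rcases hld.eq_or_lt with rfl | hlt
  · simp only [sub_self, zero_div, sub_zero, ENNReal.ofReal_one, one_mul]
    refine (lintegral_mono fun v => klDiv_map_le μ _ (measurable_frameProj v)).trans ?_
    simp
  have hlt' : (l : ℝ) < d := by exact_mod_cast hlt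
  set W : ℝ := ((d : ℝ) - l) / d with hWdef
  have hW0 : 0 < W := div_pos (by linarith) hd'
  have hW1 : W < 1 := (div_lt_one hd').mpr (by linarith)
  have hcoef : 1 - ((d : ℝ) - (l : ℝ)) / ((L / lam) * (d : ℝ)) = 1 - lam / L * W := by
    rw [hWdef]; field_simp
  have hc0 : 0 < 1 - lam / L * W := by
    have := (div_le_one hL0).mpr hLlam
    nlinarith [div_pos hlam hL0]
  rw [hcoef]
  by_cases hKL : klDiv μ (gibbsMeasure U) = ∞
  · rw [hKL, ENNReal.mul_top (by simpa using hc0)]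
    exact le_top
  have hmap : ∀ v : Stiefel l d,
      klDiv (μ.map (frameProj v)) ((gibbsMeasure U).map (frameProj v)) ≠ ∞ := fun v =>
    ne_top_of_le_ne_top hKL (klDiv_map_le μ _ (measurable_frameProj v))
  have hwsum : ∑ _j : Fin d, (d : ℝ)⁻¹ = 1 := by simp [hd'.ne']
  have hwE : ∑ _j : Fin d, ENNReal.ofReal (d : ℝ)⁻¹ = 1 := by
    rw [← ENNReal.ofReal_sum_of_nonneg fun _ _ => (inv_pos.mpr hd').le, hwsum, ENNReal.ofReal_one]
  refine lintegral_stiefelUniform_le hld hwE (fun j => Equiv.addRight j)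
    (measurable_klDiv_map μ (gibbsMeasure U) measurable_uncurry_frameProj) fun R => ?_
  have hmain := hU.sum_toReal_klDiv_map_le hd hKL (w := fun _ : Fin d => (d : ℝ)⁻¹)
    (fun _ => inv_pos.mpr hd') hwsum hW0 hW1 (columnBasis R) (fun j i => l ≤ (i - j).val)
    (fun i => by
      rw [Finset.sum_const, card_filter_le_val_sub hld, nsmul_eq_mul, Nat.cast_sub hld, hWdef,
        div_eq_mul_inv])
    (p := fun j => frameProj (frameOf hld (R * permOrth (Equiv.addRight j))))
    (fun j => measurable_frameProj _) (fun j x y => by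
      simp only [frameProj_eq_sum, frameOf_mul_permOrth]
      refine Finset.sum_congr rfl fun k _ => ?_
      congr 1
      rw [inner_add_right, inner_sum, Finset.sum_eq_zero, add_zero]
      intro i hi
      rw [inner_smul_right, (columnBasis R).inner_eq_zero, mul_zero]
      rintro rfl
      simp at hi
      omega)
  rw [← ENNReal.ofReal_toReal hKL, ← ENNReal.ofReal_mul hc0.le]
  refine le_trans (le_of_eq ?_) (ENNReal.ofReal_le_ofReal hmain)
  rw [ENNReal.ofReal_sum_of_nonneg fun j _ =>
    mul_nonneg (inv_pos.mpr hd').le ENNReal.toReal_nonneg]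
  refine Finset.sum_congr rfl fun j _ => ?_
  rw [ENNReal.ofReal_mul (inv_pos.mpr hd').le, ENNReal.ofReal_toReal (hmap _)]

/-! ### Second-order expansion of entropy and L² continuity of conditional variances. -/

/-- With `r` the second-order Taylor remainder of `log (1 + s)`, the difference equals `-s³ / 2 + (1
+ s) r`. -/
theorem abs_klFun_one_add_sub_le {s : ℝ} (hs : |s| ≤ 1 / 2) :
    |klFun (1 + s) - s ^ 2 / 2| ≤ 4 * |s| ^ 3 := by
  have h := Real.abs_log_sub_add_sum_range_le (x := -s) (by rw [abs_neg]; linarith) 2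
  simp only [Finset.sum_range_succ, Finset.range_zero, Finset.sum_empty, abs_neg, sub_neg_eq_add]
    at h
  norm_num at h
  have h1 : |s| ^ 3 / (1 - |s|) ≤ 2 * |s| ^ 3 := by
    rw [div_le_iff₀ (by linarith)]
    nlinarith [pow_nonneg (abs_nonneg s) 3]
  set r := -s + s ^ 2 / 2 + Real.log (1 + s) with hr
  have hr2 : |r| ≤ 2 * |s| ^ 3 := h.trans h1
  have e : klFun (1 + s) - s ^ 2 / 2 = -(s ^ 3 / 2) + (1 + s) * r := by
    rw [klFun_apply, hr]
    ring
  rw [e]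
  calc |-(s ^ 3 / 2) + (1 + s) * r| ≤ |-(s ^ 3 / 2)| + |(1 + s) * r| := abs_add_le _ _
    _ = |s| ^ 3 / 2 + |1 + s| * |r| := by
        rw [abs_neg, abs_div, abs_pow, abs_mul, abs_of_pos (two_pos : (0 : ℝ) < 2)]
    _ ≤ |s| ^ 3 / 2 + 3 / 2 * (2 * |s| ^ 3) := by
        have : |1 + s| ≤ 3 / 2 := (abs_add_le _ _).trans (by rw [abs_one]; linarith)
        gcongr
    _ ≤ 4 * |s| ^ 3 := by linarith [pow_nonneg (abs_nonneg s) 3]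

section Perturbation

variable {Ω : Type*} {m : MeasurableSpace Ω} [mΩ : MeasurableSpace Ω] {P : Measure Ω}
  [IsProbabilityMeasure P] {Y : Ω → ℝ} {M ε : ℝ}

theorem isProbabilityMeasure_withDensity_one_add (hY : Measurable Y) (hM : ∀ ω, |Y ω| ≤ M)
    (hY0 : ∫ ω, Y ω ∂P = 0) (hε : 0 < ε) (hεM : ε * M ≤ 1 / 2) :
    IsProbabilityMeasure (P.withDensity fun ω => ENNReal.ofReal (1 + ε * Y ω)) := by
  have hYi : Integrable Y P := Integrable.of_bound hY.aestronglyMeasurable M (.of_forall hM)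
  have hpos : ∀ ω, 0 ≤ 1 + ε * Y ω := fun ω => by
    nlinarith [(abs_le.mp (hM ω)).1]
  refine ⟨?_⟩
  rw [withDensity_apply _ MeasurableSet.univ, setLIntegral_univ,
    ← ofReal_integral_eq_lintegral_ofReal (f := fun ω => 1 + ε * Y ω)
      ((integrable_const 1).add (hYi.const_mul ε)) (.of_forall hpos),
    integral_add (integrable_const 1) (hYi.const_mul ε), integral_const_mul,
    hY0]
  simp

/-- Second order expansion of the relative entropy of the image of a small perturbation. -/
theorem abs_toReal_klDiv_withDensity_one_add_sub_le {γ : Type*} [mγ : MeasurableSpace γ]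
    (hY : Measurable Y) (hM : ∀ ω, |Y ω| ≤ M)
    (hY0 : ∫ ω, Y ω ∂P = 0) (hε : 0 < ε) (hεM : ε * M ≤ 1 / 2) {g : Ω → γ} (hg : Measurable g) :
    |(klDiv ((P.withDensity fun ω => ENNReal.ofReal (1 + ε * Y ω)).map g) (P.map g)).toReal
      - ε ^ 2 / 2 * ∫ ω, (P[Y | mγ.comap g]) ω ^ 2 ∂P| ≤ 4 * (ε * M) ^ 3 := by
  have := isProbabilityMeasure_withDensity_one_add hY hM hY0 hε hεM
  have hYi : Integrable Y P := Integrable.of_bound hY.aestronglyMeasurable M (.of_forall hM)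
  have hpos : ∀ ω, 0 ≤ 1 + ε * Y ω := fun ω => by
    nlinarith [(abs_le.mp (hM ω)).1]
  -- The image under `g` has the conditional expectation of the density, here `1 + ε E[Y | g]`, as
  -- its density. Conditioning preserves the bound `M`, so the error does not depend on `g`.
  rw [toReal_klDiv_map_of_ac (withDensity_absolutelyContinuous _ _) hg]
  have h1 : P[fun ω => ((P.withDensity fun ω => ENNReal.ofReal (1 + ε * Y ω)).rnDeriv P ω).toReal
      | mγ.comap g] =ᵐ[P] fun ω => 1 + ε * (P[Y | mγ.comap g]) ω := by
    have h2 : (fun ω => ((P.withDensity fun ω => ENNReal.ofReal (1 + ε * Y ω)).rnDeriv P ω).toReal)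
        =ᵐ[P] (fun _ => (1 : ℝ)) + ε • Y := by
      filter_upwards [Measure.rnDeriv_withDensity P
        (f := fun ω => ENNReal.ofReal (1 + ε * Y ω)) (by fun_prop)] with ω hω
      rw [hω, ENNReal.toReal_ofReal (hpos ω)]
      simp
    refine (condExp_congr_ae h2).trans ?_
    filter_upwards [condExp_add (integrable_const (1 : ℝ)) (hYi.smul ε) (mγ.comap g),
      condExp_smul ε Y (mγ.comap g) (μ := P)] with ω h3 h4
    rw [h3, Pi.add_apply, h4, condExp_const hg.comap_le]
    simp
  have hbd : ∀ᵐ ω ∂P, |(P[Y | mγ.comap g]) ω| ≤ M :=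
    ae_bdd_abs_condExp_of_ae_bdd_abs (.of_forall hM)
  have hm : AEStronglyMeasurable (P[Y | mγ.comap g]) P := integrable_condExp.aestronglyMeasurable
  have hεb : ∀ᵐ ω ∂P, |ε * (P[Y | mγ.comap g]) ω| ≤ ε * M := by
    filter_upwards [hbd] with ω hω
    rw [abs_mul, abs_of_pos hε]
    gcongr
  have hpt : ∀ᵐ ω ∂P, |klFun (1 + ε * (P[Y | mγ.comap g]) ω)
      - (ε * (P[Y | mγ.comap g]) ω) ^ 2 / 2| ≤ 4 * (ε * M) ^ 3 := by
    filter_upwards [hεb] with ω hω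
    refine (abs_klFun_one_add_sub_le (hω.trans hεM)).trans ?_
    gcongr
  have hsq : Integrable (fun ω => (ε * (P[Y | mγ.comap g]) ω) ^ 2 / 2) P := by
    refine Integrable.of_bound (C := (ε * M) ^ 2 / 2)
      ((by fun_prop : Continuous fun s : ℝ => (ε * s) ^ 2 / 2).comp_aestronglyMeasurable hm) ?_
    filter_upwards [hεb] with ω hω
    rw [Real.norm_eq_abs, abs_div, abs_pow, abs_of_pos (two_pos : (0 : ℝ) < 2)]
    gcongr
  have hdiff : Integrable (fun ω => klFun (1 + ε * (P[Y | mγ.comap g]) ω)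
      - (ε * (P[Y | mγ.comap g]) ω) ^ 2 / 2) P :=
    Integrable.of_bound ((continuous_klFun.comp_aestronglyMeasurable
      ((hm.const_mul ε).const_add 1)).sub hsq.aestronglyMeasurable) _ hpt
  have e1 : ∫ ω, klFun ((P[fun ω => ((P.withDensity fun ω =>
      ENNReal.ofReal (1 + ε * Y ω)).rnDeriv P ω).toReal | mγ.comap g]) ω) ∂P
      = ∫ ω, klFun (1 + ε * (P[Y | mγ.comap g]) ω) ∂P := by
    refine integral_congr_ae ?_
    filter_upwards [h1] with ω hω
    rw [hω]
  have e2 : ε ^ 2 / 2 * ∫ ω, (P[Y | mγ.comap g]) ω ^ 2 ∂P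
      = ∫ ω, (ε * (P[Y | mγ.comap g]) ω) ^ 2 / 2 ∂P := by
    rw [← integral_const_mul]
    refine integral_congr_ae (.of_forall fun ω => ?_)
    dsimp only
    ring
  have hk : Integrable (fun ω => klFun (1 + ε * (P[Y | mγ.comap g]) ω)) P := by
    simpa [Pi.add_def] using hdiff.add hsq
  rw [e1, e2, ← integral_sub hk hsq]
  refine (norm_integral_le_of_norm_le_const (C := 4 * (ε * M) ^ 3)
    (f := fun ω => klFun (1 + ε * (P[Y | mγ.comap g]) ω) - (ε * (P[Y | mγ.comap g]) ω) ^ 2 / 2)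
    hpt).trans ?_
  simp

theorem klDiv_withDensity_one_add_ne_top
    (hY : Measurable Y) (hM : ∀ ω, |Y ω| ≤ M)
    (hY0 : ∫ ω, Y ω ∂P = 0) (hε : 0 < ε) (hεM : ε * M ≤ 1 / 2) :
    klDiv (P.withDensity fun ω => ENNReal.ofReal (1 + ε * Y ω)) P ≠ ∞ := by
  have := isProbabilityMeasure_withDensity_one_add hY hM hY0 hε hεM
  refine klDiv_ne_top (withDensity_absolutelyContinuous _ _) ?_
  have hae := withDensity_absolutelyContinuous P (fun ω => ENNReal.ofReal (1 + ε * Y ω)) |>.ae_le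
    (Measure.rnDeriv_withDensity P (f := fun ω => ENNReal.ofReal (1 + ε * Y ω)) (by fun_prop))
  refine Integrable.of_bound (measurable_llr _ _).aestronglyMeasurable (Real.log 2) ?_
  filter_upwards [hae] with ω hω
  have h1 := mul_le_mul_of_nonneg_left (abs_le.mp (hM ω)).1 hε.le
  have h2 := mul_le_mul_of_nonneg_left (abs_le.mp (hM ω)).2 hε.le
  rw [llr, hω, ENNReal.toReal_ofReal (by nlinarith), Real.norm_eq_abs, abs_le, ← Real.log_inv]
  exact ⟨Real.log_le_log (by norm_num) (by nlinarith),
    Real.log_le_log (by nlinarith) (by nlinarith)⟩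

theorem integral_sq_condExp_eq_norm_sq (hm : m ≤ mΩ) (hY : MemLp Y 2 P) :
    ∫ ω, (P[Y | m]) ω ^ 2 ∂P = ‖condExpL2 ℝ ℝ hm (hY.toLp Y)‖ ^ 2 := by
  rw [← Submodule.norm_coe, ← real_inner_self_eq_norm_sq, L2.inner_def]
  refine integral_congr_ae ?_
  filter_upwards [hY.condExpL2_ae_eq_condExp (𝕜 := ℝ) hm] with ω hω
  rw [hω]
  simp [sq]

/-- Both terms are squared norms of L² projections, the one onto constants giving the squared mean.
This makes the variance visibly continuous in `Y` for the L² norm. -/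
theorem variance_condExp_eq (hm : m ≤ mΩ) (hY : MemLp Y 2 P) :
    variance (P[Y | m]) P = ‖condExpL2 ℝ ℝ hm (hY.toLp Y)‖ ^ 2
      - ‖condExpL2 ℝ ℝ (bot_le : ⊥ ≤ mΩ) (hY.toLp Y)‖ ^ 2 := by
  rw [← integral_sq_condExp_eq_norm_sq, ← integral_sq_condExp_eq_norm_sq,
    variance_eq_sub (hY.condExp one_le_two), integral_condExp hm, condExp_bot]
  simp

theorem tendsto_variance_condExp (hm : m ≤ mΩ) (hY : MemLp Y 2 P)
    {Z : ℕ → Ω → ℝ} (hZ : ∀ n, MemLp (Z n) 2 P)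
    (hlim : Filter.Tendsto (fun n => eLpNorm (Z n - Y) 2 P) Filter.atTop (nhds 0)) :
    Filter.Tendsto (fun n => variance (P[Z n | m]) P) Filter.atTop
      (nhds (variance (P[Y | m]) P)) := by
  have h := (Lp.tendsto_Lp_iff_tendsto_eLpNorm'' Z hZ Y hY).mpr hlim
  simp only [variance_condExp_eq hm hY, fun n => variance_condExp_eq hm (hZ n)]
  exact ((((condExpL2 ℝ ℝ hm).continuous.tendsto _).comp h).norm.pow 2).sub
    ((((condExpL2 ℝ ℝ (bot_le : ⊥ ≤ mΩ)).continuous.tendsto _).comp h).norm.pow 2)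

theorem variance_condExp_le (hm : m ≤ mΩ) (hY : MemLp Y 2 P) :
    variance (P[Y | m]) P ≤ variance Y P := by
  have h1 := integral_condVar_add_variance_condExp hm hY
  have h2 : 0 ≤ ∫ ω, condVar m Y P ω ∂P :=
    integral_nonneg_of_ae (condExp_nonneg (.of_forall fun ω => sq_nonneg _))
  linarith

end Perturbation

/-! ### Variance contraction under random projections. -/

theorem IsConvexSmooth.contraction_coefficient_nonneg {d l : ℕ} (hl1 : 1 ≤ l) (hld : l ≤ d)
    {U : EuclideanSpace ℝ (Fin d) → ℝ} {lam L : ℝ} (hU : IsConvexSmooth U lam L) :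
    0 ≤ 1 - ((d : ℝ) - (l : ℝ)) / ((L / lam) * (d : ℝ)) := by
  have hd : 0 < d := hl1.trans hld
  have hd' : (0 : ℝ) < d := by exact_mod_cast hd
  have hκ : 1 ≤ L / lam := (one_le_div hU.lam_pos).mpr (hU.lam_le hd)
  have hl0 : (0 : ℝ) ≤ l := l.cast_nonneg
  rw [sub_nonneg, div_le_one (by positivity)]
  nlinarith

/-- Averaged contraction of the variance under conditioning on random projections, for bounded
functions. -/
theorem IsConvexSmooth.integral_variance_condExp_le_of_bounded {d l : ℕ} (hl1 : 1 ≤ l)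
    (hld : l ≤ d) {U : EuclideanSpace ℝ (Fin d) → ℝ} {lam L : ℝ} (hU : IsConvexSmooth U lam L)
    [IsProbabilityMeasure (gibbsMeasure U)] {Ω : Type*} [MeasurableSpace Ω] {P : Measure Ω}
    [IsProbabilityMeasure P] {X : Ω → EuclideanSpace ℝ (Fin d)} (hX : Measurable X)
    (hPX : P.map X = gibbsMeasure U) {F : Ω → ℝ} (hF : Measurable F) {M : ℝ}
    (hM : ∀ ω, |F ω| ≤ M) :
    Measurable (fun v : Stiefel l d => variance
      (P[F | MeasurableSpace.comap (fun ω => frameProj v (X ω)) inferInstance]) P) ∧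
    ∫ v : Stiefel l d, variance
        (P[F | MeasurableSpace.comap (fun ω => frameProj v (X ω)) inferInstance]) P
        ∂(stiefelUniform hld)
      ≤ (1 - ((d : ℝ) - (l : ℝ)) / ((L / lam) * (d : ℝ))) * variance F P := by
  set c := 1 - ((d : ℝ) - (l : ℝ)) / ((L / lam) * (d : ℝ)) with hc
  have hc0 : 0 ≤ c := hU.contraction_coefficient_nonneg hl1 hld
  set Ψ : Stiefel l d → ℝ := fun v => variance
      (P[F | MeasurableSpace.comap (fun ω => frameProj v (X ω)) inferInstance]) P with hΨ
  have hpX : ∀ v : Stiefel l d, Measurable fun ω => frameProj v (X ω) := fun v =>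
    (measurable_frameProj v).comp hX
  have hFi : Integrable F P := Integrable.of_bound hF.aestronglyMeasurable M (.of_forall hM)
  set a := ∫ ω, F ω ∂P with ha
  set Y : Ω → ℝ := fun ω => F ω - a with hYdef
  have hY : Measurable Y := hF.sub_const a
  have hM0 : 0 ≤ M := by
    obtain ⟨ω⟩ := nonempty_of_isProbabilityMeasure P
    exact (abs_nonneg _).trans (hM ω)
  have haM : |a| ≤ M := by
    simpa using norm_integral_le_of_norm_le_const (μ := P) (f := F) (.of_forall hM)
  -- The summand `1` keeps `N` positive when `M = 0`, so that `ε n` can be chosen with `ε n * N ≤ 1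
  -- / 2`.
  set N := 2 * M + 1 with hN
  have hN0 : 0 < N := by linarith
  have hYN : ∀ ω, |Y ω| ≤ N := fun ω => (abs_sub _ _).trans (by linarith [hM ω])
  have hY0 : ∫ ω, Y ω ∂P = 0 := by
    rw [hYdef, integral_sub hFi (integrable_const a)]
    simp [ha]
  have hvar : ∀ v : Stiefel l d, ∫ ω,
      (P[Y | MeasurableSpace.comap (fun ω => frameProj v (X ω)) inferInstance]) ω ^ 2 ∂P
        = Ψ v := by
    intro v
    rw [hΨ]
    dsimp only
    rw [variance_eq_integral integrable_condExp.aemeasurable, integral_condExp (hpX v).comap_le]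
    refine integral_congr_ae ?_
    filter_upwards [condExp_sub hFi (integrable_const a)
      (MeasurableSpace.comap (fun ω => frameProj v (X ω)) inferInstance)] with ω hω
    have : Y = F - fun _ => a := rfl
    rw [this, hω, Pi.sub_apply, condExp_const (hpX v).comap_le]
  have hvarF : ∫ ω, Y ω ^ 2 ∂P = variance F P := by
    rw [variance_eq_integral hF.aemeasurable]
  set ε : ℕ → ℝ := fun n => (2 * N)⁻¹ * (1 / ((n : ℝ) + 1)) with hε
  have hε0 : ∀ n, 0 < ε n := fun n => by positivity
  have hεN : ∀ n, ε n * N ≤ 1 / 2 := by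
    intro n
    have h1 : 1 / ((n : ℝ) + 1) ≤ 1 := by
      rw [div_le_one (by positivity)]
      linarith [n.cast_nonneg (α := ℝ)]
    calc ε n * N = 1 / 2 * (1 / ((n : ℝ) + 1)) := by rw [hε]; field_simp
      _ ≤ 1 / 2 := by linarith
  have hεlim : Filter.Tendsto ε Filter.atTop (nhds 0) := by
    have := (tendsto_one_div_add_atTop_nhds_zero_nat (𝕜 := ℝ)).const_mul (2 * N)⁻¹
    rwa [mul_zero] at this
  set Q : ℕ → Measure Ω := fun n => P.withDensity fun ω => ENNReal.ofReal (1 + ε n * Y ω) with hQ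
  have hQp : ∀ n, IsProbabilityMeasure (Q n) := fun n =>
    isProbabilityMeasure_withDensity_one_add hY hYN hY0 (hε0 n) (hεN n)
  have hQXp : ∀ n, IsProbabilityMeasure ((Q n).map X) := fun n =>
    Measure.isProbabilityMeasure_map hX.aemeasurable
  set k : ℕ → Stiefel l d → ℝ≥0∞ := fun n v =>
    klDiv (((Q n).map X).map (frameProj v)) ((gibbsMeasure U).map (frameProj v)) with hk
  have hkm : ∀ n, Measurable (k n) := fun n =>
    measurable_klDiv_map _ _ measurable_uncurry_frameProj
  have hkΨ : ∀ n v, |(k n v).toReal - ε n ^ 2 / 2 * Ψ v| ≤ 4 * (ε n * N) ^ 3 := by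
    intro n v
    rw [← hvar v, hk]
    dsimp only
    rw [← hPX, Measure.map_map (measurable_frameProj v) hX,
      Measure.map_map (measurable_frameProj v) hX]
    exact abs_toReal_klDiv_withDensity_one_add_sub_le hY hYN hY0 (hε0 n) (hεN n) (hpX v)
  have hQtop : ∀ n, klDiv (Q n) P ≠ ∞ := fun n =>
    klDiv_withDensity_one_add_ne_top hY hYN hY0 (hε0 n) (hεN n)
  have hQkl : ∀ n, (klDiv (Q n) P).toReal ≤ ε n ^ 2 / 2 * variance F P + 4 * (ε n * N) ^ 3 := by
    intro n
    have h := abs_toReal_klDiv_withDensity_one_add_sub_le hY hYN hY0 (hε0 n) (hεN n)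
      (P := P) measurable_id
    rw [Measure.map_id, Measure.map_id, MeasurableSpace.comap_id,
      condExp_of_stronglyMeasurable le_rfl hY.stronglyMeasurable
        (hFi.sub (integrable_const a)), hvarF] at h
    linarith [(abs_le.mp h).2]
  -- Contraction is applied to the law of `X` under `Q n`, whose entropy is at most that of `Q n`
  -- relative to `P`.
  have hkle : ∀ n, ∫⁻ v, k n v ∂(stiefelUniform hld) ≤ ENNReal.ofReal c * klDiv (Q n) P := by
    intro n
    refine (hU.lintegral_klDiv_map_frameProj_le hl1 hld ((Q n).map X)).trans ?_
    gcongr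
    rw [← hPX]
    exact klDiv_map_le _ _ hX
  have hktop : ∀ n, ∫⁻ v, k n v ∂(stiefelUniform hld) ≠ ∞ := fun n =>
    ne_top_of_le_ne_top (ENNReal.mul_ne_top ENNReal.ofReal_ne_top (hQtop n)) (hkle n)
  have hkint : ∀ n, ∫ v, (k n v).toReal ∂(stiefelUniform hld)
      ≤ c * (ε n ^ 2 / 2 * variance F P + 4 * (ε n * N) ^ 3) := by
    intro n
    rw [integral_toReal (hkm n).aemeasurable (ae_lt_top (hkm n) (hktop n))]
    have h := ENNReal.toReal_mono (ENNReal.mul_ne_top ENNReal.ofReal_ne_top (hQtop n)) (hkle n)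
    rw [ENNReal.toReal_mul, ENNReal.toReal_ofReal hc0] at h
    exact h.trans (mul_le_mul_of_nonneg_left (hQkl n) hc0)
  -- Rescaled entropies approximate `Ψ` uniformly in `v`; this gives both the measurability of `Ψ`
  -- and the integral bound.
  have happ : ∀ n v, |2 / ε n ^ 2 * (k n v).toReal - Ψ v| ≤ 8 * N ^ 3 * ε n := by
    intro n v
    have hp := hε0 n
    have e : 2 / ε n ^ 2 * (k n v).toReal - Ψ v
        = 2 / ε n ^ 2 * ((k n v).toReal - ε n ^ 2 / 2 * Ψ v) := by
      field_simp
    rw [e, abs_mul, abs_of_pos (by positivity)]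
    calc 2 / ε n ^ 2 * |(k n v).toReal - ε n ^ 2 / 2 * Ψ v|
        ≤ 2 / ε n ^ 2 * (4 * (ε n * N) ^ 3) := by
          gcongr
          exact hkΨ n v
      _ = 8 * N ^ 3 * ε n := by field_simp; ring
  have hlim0 : Filter.Tendsto (fun n => 8 * N ^ 3 * ε n) Filter.atTop (nhds 0) := by
    simpa using hεlim.const_mul (8 * N ^ 3)
  have hΨm : Measurable Ψ := by
    refine measurable_of_tendsto_metrizable (f := fun n v => 2 / ε n ^ 2 * (k n v).toReal)
      (fun n => (hkm n).ennreal_toReal.const_mul _) (tendsto_pi_nhds.mpr fun v => ?_)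
    rw [tendsto_iff_dist_tendsto_zero]
    exact squeeze_zero (fun n => dist_nonneg) (fun n => happ n v) hlim0
  refine ⟨hΨm, ?_⟩
  have hstep : ∀ n, ∫ v, Ψ v ∂(stiefelUniform hld)
      ≤ c * variance F P + c * (8 * N ^ 3 * ε n) + 8 * N ^ 3 * ε n := by
    intro n
    have hp := hε0 n
    have hki : Integrable (fun v => 2 / ε n ^ 2 * (k n v).toReal) (stiefelUniform hld) :=
      (integrable_toReal_of_lintegral_ne_top (hkm n).aemeasurable (hktop n)).const_mul _
    calc ∫ v, Ψ v ∂(stiefelUniform hld)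
        ≤ ∫ v, (2 / ε n ^ 2 * (k n v).toReal + 8 * N ^ 3 * ε n) ∂(stiefelUniform hld) := by
          refine integral_mono_of_nonneg (.of_forall fun v => variance_nonneg _ _)
            (hki.add (integrable_const _)) (.of_forall fun v => ?_)
          have := (abs_le.mp (happ n v)).1
          dsimp only
          linarith
      _ = 2 / ε n ^ 2 * ∫ v, (k n v).toReal ∂(stiefelUniform hld) + 8 * N ^ 3 * ε n := by
          rw [integral_add hki (integrable_const _), integral_const_mul]
          simp
      _ ≤ 2 / ε n ^ 2 * (c * (ε n ^ 2 / 2 * variance F P + 4 * (ε n * N) ^ 3))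
          + 8 * N ^ 3 * ε n := by
          gcongr
          exact hkint n
      _ = c * variance F P + c * (8 * N ^ 3 * ε n) + 8 * N ^ 3 * ε n := by
          field_simp
          ring
  have hl := ((hlim0.const_mul c).const_add (c * variance F P)).add hlim0
  rw [mul_zero, add_zero, add_zero] at hl
  exact ge_of_tendsto' hl hstep

/-- Averaged contraction of the variance under conditioning on random projections. -/
theorem IsConvexSmooth.integral_variance_condExp_le {d l : ℕ} (hl1 : 1 ≤ l)
    (hld : l ≤ d) {U : EuclideanSpace ℝ (Fin d) → ℝ} {lam L : ℝ} (hU : IsConvexSmooth U lam L)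
    [IsProbabilityMeasure (gibbsMeasure U)] {Ω : Type*} [MeasurableSpace Ω] {P : Measure Ω}
    [IsProbabilityMeasure P] {X : Ω → EuclideanSpace ℝ (Fin d)} (hX : Measurable X)
    (hPX : P.map X = gibbsMeasure U) {f : EuclideanSpace ℝ (Fin d) → ℝ}
    (hf : MemLp f 2 (gibbsMeasure U)) :
    Measurable (fun v : Stiefel l d => variance
      (P[fun ω => f (X ω) | MeasurableSpace.comap (fun ω => frameProj v (X ω)) inferInstance]) P) ∧
    ∫ v : Stiefel l d, variance
        (P[fun ω => f (X ω) | MeasurableSpace.comap (fun ω => frameProj v (X ω)) inferInstance]) P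
        ∂(stiefelUniform hld)
      ≤ (1 - ((d : ℝ) - (l : ℝ)) / ((L / lam) * (d : ℝ))) * variance (fun ω => f (X ω)) P := by
  have hpX : ∀ v : Stiefel l d, Measurable fun ω => frameProj v (X ω) := fun v =>
    (measurable_frameProj v).comp hX
  rw [← hPX] at hf
  have hfX : MemLp (fun ω => f (X ω)) 2 P := hf.comp_of_map hX.aemeasurable
  choose g hg hgL using fun n : ℕ => hf.exists_simpleFunc_eLpNorm_sub_lt (ε := ((n : ℝ≥0∞) + 1)⁻¹)
    ENNReal.ofNat_ne_top (by simp)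
  set Z : ℕ → Ω → ℝ := fun n ω => g n (X ω) with hZ
  have hZm : ∀ n, Measurable (Z n) := fun n => (g n).measurable.comp hX
  have hZL : ∀ n, MemLp (Z n) 2 P := fun n => (hgL n).comp_of_map hX.aemeasurable
  have hlim : Filter.Tendsto (fun n => eLpNorm (Z n - fun ω => f (X ω)) 2 P) Filter.atTop
      (nhds 0) := by
    have h0 : Filter.Tendsto (fun n : ℕ => ((n : ℝ≥0∞) + 1)⁻¹) Filter.atTop (nhds 0) := by
      have := (ENNReal.tendsto_inv_nat_nhds_zero).comp (Filter.tendsto_add_atTop_nat 1)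
      simpa [Function.comp_def] using this
    refine tendsto_of_tendsto_of_tendsto_of_le_of_le tendsto_const_nhds h0 (fun _ => zero_le)
      fun n => ?_
    have h1 := eLpNorm_map_measure (p := 2) (μ := P) (f := X) (g := f - ⇑(g n))
      (hf.sub (hgL n)).aestronglyMeasurable hX.aemeasurable
    dsimp only
    rw [eLpNorm_sub_comm]
    exact h1.symm.trans_le (hg n).le
  have hbounded : ∀ n, ∃ C, ∀ ω, |Z n ω| ≤ C := by
    intro n
    obtain ⟨C, hC⟩ := (g n).exists_forall_norm_le
    exact ⟨C, fun ω => hC _⟩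
  choose C hC using hbounded
  have hb := fun n =>
    hU.integral_variance_condExp_le_of_bounded hl1 hld hX hPX (hZm n) (hC n)
  have hptw : ∀ v : Stiefel l d, Filter.Tendsto (fun n => variance
      (P[Z n | MeasurableSpace.comap (fun ω => frameProj v (X ω)) inferInstance]) P) Filter.atTop
      (nhds (variance
      (P[fun ω => f (X ω) | MeasurableSpace.comap (fun ω => frameProj v (X ω)) inferInstance])
        P)) := fun v =>
    tendsto_variance_condExp (hpX v).comap_le hfX hZL hlim
  have hvar : Filter.Tendsto (fun n => variance (Z n) P) Filter.atTop
      (nhds (variance (fun ω => f (X ω)) P)) := by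
    -- Conditioning on the full σ-algebra changes nothing, so the same continuity lemma gives
    -- convergence of the plain variances, and hence a constant dominating bound.
    have h := tendsto_variance_condExp le_rfl hfX hZL hlim
    have h1 : ∀ n, variance (P[Z n | inferInstance]) P = variance (Z n) P := fun n => by
      rw [condExp_of_stronglyMeasurable le_rfl (hZm n).stronglyMeasurable
        ((hZL n).integrable one_le_two)]
    have h2 : variance (P[fun ω => f (X ω) | inferInstance]) P
        = variance (fun ω => f (X ω)) P :=
      variance_congr (condExp_of_aestronglyMeasurable' le_rfl hfX.aestronglyMeasurable
        (hfX.integrable one_le_two))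
    rw [h2] at h
    exact h.congr h1
  refine ⟨measurable_of_tendsto_metrizable (fun n => (hb n).1) (tendsto_pi_nhds.mpr hptw), ?_⟩
  obtain ⟨B, hB⟩ := hvar.bddAbove_range
  have hint := tendsto_integral_of_dominated_convergence (μ := stiefelUniform hld) (fun _ => B)
    (fun n => (hb n).1.aestronglyMeasurable) (integrable_const B)
    (fun n => .of_forall fun v => by
      rw [Real.norm_of_nonneg (variance_nonneg _ _)]
      exact (variance_condExp_le (hpX v).comap_le (hZL n)).trans (hB ⟨n, rfl⟩))
    (.of_forall hptw)
  exact le_of_tendsto_of_tendsto' hint (hvar.const_mul _) fun n => (hb n).2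

theorem mainTheorem8 {d l : ℕ} (hl1 : 1 ≤ l) (hld : l ≤ d)
    (U : EuclideanSpace ℝ (Fin d) → ℝ) (lam L : ℝ) (hU : IsConvexSmooth U lam L)
    (hprob : IsProbabilityMeasure (gibbsMeasure U)) :
    (∀ μ : Measure (EuclideanSpace ℝ (Fin d)), IsProbabilityMeasure μ →
      AEMeasurable
        (fun v : Stiefel l d =>
          klDiv (μ.map (frameProj v)) ((gibbsMeasure U).map (frameProj v)))
        (stiefelUniform hld) ∧
      ∫⁻ v : Stiefel l d,
          klDiv (μ.map (frameProj v)) ((gibbsMeasure U).map (frameProj v))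
          ∂(stiefelUniform hld)
        ≤ ENNReal.ofReal (1 - ((d : ℝ) - (l : ℝ)) / ((L / lam) * (d : ℝ)))
          * klDiv μ (gibbsMeasure U)) ∧
    (∀ {Ω : Type*} [MeasurableSpace Ω] (P : Measure Ω) [IsProbabilityMeasure P]
      (X : Ω → EuclideanSpace ℝ (Fin d)), Measurable X → P.map X = gibbsMeasure U →
      ∀ f : EuclideanSpace ℝ (Fin d) → ℝ, MemLp f 2 (gibbsMeasure U) →
        Integrable
          (fun v : Stiefel l d =>
            ∫ ω, condVar (MeasurableSpace.comap (fun ω => frameProj v (X ω)) inferInstance)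
              (fun ω => f (X ω)) P ω ∂P)
          (stiefelUniform hld) ∧
        ∫ v : Stiefel l d,
            (∫ ω, condVar (MeasurableSpace.comap (fun ω => frameProj v (X ω)) inferInstance)
              (fun ω => f (X ω)) P ω ∂P)
            ∂(stiefelUniform hld)
          ≥ ((d : ℝ) - (l : ℝ)) / (2 * (L / lam) * (d : ℝ))
            * variance (fun ω => f (X ω)) P) := by
  refine ⟨fun μ _ => ⟨(measurable_klDiv_map μ _ measurable_uncurry_frameProj).aemeasurable,
    hU.lintegral_klDiv_map_frameProj_le hl1 hld μ⟩, ?_⟩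
  intro Ω _ P _ X hX hPX f hf
  obtain ⟨hm, hle⟩ := hU.integral_variance_condExp_le hl1 hld hX hPX hf
  have hfX : MemLp (fun ω => f (X ω)) 2 P := (hPX ▸ hf).comp_of_map hX.aemeasurable
  have hpX : ∀ v : Stiefel l d, Measurable fun ω => frameProj v (X ω) := fun v =>
    (measurable_frameProj v).comp hX
  have hcond : ∀ v : Stiefel l d,
      ∫ ω, condVar (MeasurableSpace.comap (fun ω => frameProj v (X ω)) inferInstance)
        (fun ω => f (X ω)) P ω ∂P = variance (fun ω => f (X ω)) P - variance
          (P[fun ω => f (X ω) | MeasurableSpace.comap (fun ω => frameProj v (X ω)) inferInstance])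
          P := fun v =>
    eq_sub_of_add_eq (integral_condVar_add_variance_condExp (hpX v).comap_le hfX)
  have hΨ : Integrable (fun v : Stiefel l d => variance
      (P[fun ω => f (X ω) | MeasurableSpace.comap (fun ω => frameProj v (X ω)) inferInstance]) P)
      (stiefelUniform hld) :=
    Integrable.of_bound hm.aestronglyMeasurable (variance (fun ω => f (X ω)) P)
      (.of_forall fun v => by
        rw [Real.norm_of_nonneg (variance_nonneg _ _)]
        exact variance_condExp_le (hpX v).comap_le hfX)
  simp only [hcond]
  refine ⟨(integrable_const _).sub hΨ, ?_⟩
  rw [integral_sub (integrable_const _) hΨ, integral_const, probReal_univ, one_smul, ge_iff_le]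
  have hd' : (0 : ℝ) < d := by exact_mod_cast hl1.trans hld
  have hdl : (0 : ℝ) ≤ (d : ℝ) - l := sub_nonneg.mpr (by exact_mod_cast hld)
  have hκ : 0 < L / lam := div_pos (hU.lam_pos.trans_le (hU.lam_le (hl1.trans hld))) hU.lam_pos
  have hx : 0 ≤ ((d : ℝ) - l) / ((L / lam) * d) * variance (fun ω => f (X ω)) P :=
    mul_nonneg (div_nonneg hdl (by positivity)) (variance_nonneg _ _)
  -- The required constant is half of the one that the law of total variance has produced.
  have he : ((d : ℝ) - l) / (2 * (L / lam) * d) = ((d : ℝ) - l) / ((L / lam) * d) / 2 := by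
    rw [div_div]
    ring
  rw [he]
  linarith
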